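/- **Model.** $K$ users access a base station (BS) over $C$ sub-channels, possibly aided by a reconfigurable intelligent surface (RIS) with $M=2^{\overline J+1}$ reflecting elements, $\overline J\ge1$. A time frame consists of phases $n=1,2,\dots$. In phase $n$, each user picks one of $S\ge1$ preambles uniformly at random; $\mathcal I_n$ is the set of users whose preamble is picked by no other user. The direct gains $h_{d,k}^c(n)\sim\mathcal{CN}(0,d_s^{-\alpha_1})$ and the RIS gains $f_{k,c}^m(n)\sim\mathcal{CN}(0,d_{r,1}^{-\alpha_2})$, $g_{k,c}^m(n)\sim\mathcal{CN}(0,d_{r,2}^{-\alpha_2})$ are circularly symmetric complex Gaussian; all these variables are independent, also of the preambles and across phases. Here $d_s,d_{r,1},d_{r,2}>0$. Let $T_c,\tau_{\rm RA},\tau_s>0$ be the coherence time, the duration of a random-request phase and the pilot duration; $\tau_{\rm CE}(J)=2^{J+1}\tau_s$ is the duration of probing at grouping level $J$, and $\tau_{\rm CE}(\overline J)\le T_c$. Let $\overline\gamma=P_t\beta_0/N_0>0$. After the request phase the BS knows $\mathcal I_n$ and $\mathbf h_d(n)=(h_{d,k}^c(n))_{k\in\mathcal I_n,c}$, and may 1.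 transmit directly ($\psi_n=0$) for a time $T_c$ at the rate $R_{d,n}^*=\sum_{c:\,a_c\ne0}\log_2(1+\overline\gamma|h_{d,a_c}^c(n)|^2)$, where $\mathbf a$ is the greedy schedule: go through the pairs (user in $\mathcal I_n$, sub-channel) in descending order of $|h_{d,k}^c(n)|$ and assign a pair if neither its user nor its sub-channel has been used; 2. skip to phase $n+1$ ($\psi_n=\overline J+1$); 3. probe the RIS at a level $\psi_n=J\in\{1,\dots,\overline J\}$ with a vector $\varphi_n=\mathbf b\in(\mathcal I_n\cup\{0\})^C$ (where $0$ means unprobed). This takes the time $\tau_{\rm CE}(J)$ and reveals, for $b_c\ne0$ and $1\le u\le2^J$, the grouped gains $h_{b_c,c,u}=\sum_{m=1}^{B}f_{b_c,c}^{(u-1)B+m}(n)\,g_{b_c,c}^{(u-1)B+m}(n)$, $B=2^{\overline J-J}$. Then the BS either transmits ($\eta_n=0$) for a time $T_c-\tau_{\rm CE}(J)$ at the rate $$R_{r,n}(\mathbf b)=\sum_{c:\,b_c\ne0}\log_2\Big(1+\overline\gamma\Big|h_{d,b_c}^c(n)+\sum_{u=1}^{2^J}h_{b_c,c,u}\,e^{j(\arg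 h_{d,b_c}^c(n)-\arg h_{b_c,c,u})}\Big|^2\Big),$$ or skips to phase $n+1$ ($\eta_n=1$). A strategy makes each decision as a measurable function of everything observed so far. $N$ denotes the first phase after which it transmits, $Y_N$ the transmitted volume (rate times transmission time; $0$ if $N=\infty$), and $$T_N=N\tau_{\rm RA}+\sum_{l<N,\ 1\le\psi_l\le\overline J}\tau_{\rm CE}(\psi_l)+T_c$$ the duration of the frame ($T_N=\infty$ if $N=\infty$). Let $\lambda^*=\sup\mathbb E[Y_N]/\mathbb E[T_N]$ be the supremum over all strategies for which the two expectations are not both infinite, and let $$\Theta_{(\mathbf b,J)}(\lambda,\mathbf h_d)=\mathbb E\big[\max\{(T_c-\tau_{\rm CE}(J))R_r(\mathbf b)-\lambda T_c,\,-\lambda\tau_{\rm CE}(J)\}\,\big|\,\mathbf h_d\big].$$ **Theorem 1.** $\lambda^*$ is finite and is attained by a strategy with the following two-level threshold structure. After phase $n$, with all maxima over $J\in\{1,\dots,\overline J\}$ and $\mathbf b\in(\mathcal I_n\cup\{0\})^C$: 1. if $(R_{d,n}^*-\lambda^*)T_c\ge\max\{\max_{\mathbf b,J}\Theta_{(\mathbf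 b,J)}(\lambda^*,\mathbf h_d(n)),0\}$, transmit directly; 2. if $\max\{(R_{d,n}^*-\lambda^*)T_c,\max_{\mathbf b,J}\Theta_{(\mathbf b,J)}(\lambda^*,\mathbf h_d(n))\}<0$, skip to the next phase; 3. otherwise probe the RIS at a level $J$ and with a vector $\mathbf b$ that maximize $\Theta_{(\mathbf b,J)}(\lambda^*,\mathbf h_d(n))$; after probing, transmit if $R_{r,n}(\mathbf b)\ge\lambda^*$ and skip to the next phase otherwise. Such strategies exist, and every one of them has $N<\infty$ almost surely, $\mathbb E[T_N]<\infty$, $\mathbb E[Y_N]<\infty$ and $\mathbb E[Y_N]/\mathbb E[T_N]=\lambda^*$. Moreover $\lambda=\lambda^*$ is the unique real solution of $$\mathbb E\big[\max\{(R_d^*-\lambda)T_c,\,0,\,\max_{\mathbf b,J}\Theta_{(\mathbf b,J)}(\lambda,\mathbf h_d)\}\big]=\lambda\,\tau_{\rm RA}.$$ -/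

import Mathlib

open MeasureTheory ProbabilityTheory
open scoped ENNReal NNReal

noncomputable section

namespace RISAccess

/-- The circularly symmetric complex Gaussian law with mean zero and variance `v`: real and
imaginary parts are independent centred real Gaussians of variance `v / 2`. -/
def complexGaussian (v : ℝ≥0) : Measure ℂ :=
  ((gaussianReal 0 (v / 2)).prod (gaussianReal 0 (v / 2))).map (fun q : ℝ × ℝ => Complex.mk q.1 q.2)

/-- Parameters of the RIS-aided random access network. -/
structure Network where
  /-- number of users -/
  K : ℕ
  /-- number of sub-channels -/
  C : ℕ
  /-- number of preambles -/
  S : ℕ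
  /-- maximal subarray grouping level -/
  Jbar : ℕ
  /-- distances of the user-BS, user-RIS and RIS-BS links -/
  dS : ℝ
  dR1 : ℝ
  dR2 : ℝ
  /-- path loss exponents of direct and RIS links -/
  α1 : ℝ
  α2 : ℝ
  /-- transmit power, reference path loss, noise power -/
  Pt : ℝ
  β0 : ℝ
  N0 : ℝ
  /-- coherence time, duration of a random-request phase, pilot duration for one element -/
  Tc : ℝ
  τRA : ℝ
  τs : ℝ
  S_pos : 0 < S
  Jbar_pos : 0 < Jbar
  dS_pos : 0 < dS
  dR1_pos : 0 < dR1
  dR2_pos : 0 < dR2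
  Pt_pos : 0 < Pt
  β0_pos : 0 < β0
  N0_pos : 0 < N0
  Tc_pos : 0 < Tc
  τRA_pos : 0 < τRA
  τs_pos : 0 < τs
  /-- the longest channel estimation fits into the coherence time, so that the transmission time
  left after probing is never negative -/
  probe_fits : 2 ^ (Jbar + 1) * τs ≤ Tc

namespace Network

variable (p : Network)

/-- Number of reflecting elements of the RIS. -/
def M : ℕ := 2 ^ (p.Jbar + 1)

/-- The transmit signal-to-noise ratio `γ̄`. -/
def γ : ℝ := p.Pt * p.β0 / p.N0

/-- Duration of channel estimation at grouping level `J`. -/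
def τCE (J : ℕ) : ℝ := 2 ^ (J + 1) * p.τs

/-- An allocation of sub-channels: `none` is an unused sub-channel. -/
abbrev Alloc : Type := Fin p.C → Option (Fin p.K)

/-- Gains `f` (user-RIS) and `g` (RIS-BS) for each user, sub-channel and reflecting element. -/
abbrev RISGains : Type :=
  (Fin p.K → Fin p.C → Fin p.M → ℂ) × (Fin p.K → Fin p.C → Fin p.M → ℂ)

/-- What nature draws in one phase: the preamble of each user, the direct gains, the RIS gains. -/
abbrev Phase : Type :=
  ((Fin p.K → Fin p.S) × (Fin p.K → Fin p.C → ℂ)) × p.RISGains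

/-- What the BS observes in a random-request phase: the set of granted users, and their direct
gains (the entries of the users that are not granted are replaced by zero). -/
abbrev Request : Type := Finset (Fin p.K) × (Fin p.K → Fin p.C → ℂ)

/-- What the BS observes by probing: for each sub-channel, the grouped cascaded gains of the
subarrays (padded with zeros beyond the number of subarrays, and zero on unprobed sub-channels). -/
abbrev ProbeObs : Type := Fin p.C → Fin (2 ^ p.Jbar) → ℂ

/-- Everything the BS observes in one phase; the second component is zero if it does not probe. -/
abbrev Record : Type := p.Request × p.ProbeObs

/-! ### Law of one phase -/

def risLaw : Measure p.RISGains :=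
  (Measure.pi fun _ => Measure.pi fun _ => Measure.pi fun _ =>
      complexGaussian (p.dR1 ^ (-p.α2)).toNNReal).prod
    (Measure.pi fun _ => Measure.pi fun _ => Measure.pi fun _ =>
      complexGaussian (p.dR2 ^ (-p.α2)).toNNReal)

/-- Each user chooses one of the preambles uniformly, all gains are complex Gaussian, and all
these variables are independent. -/
def phaseLaw : Measure p.Phase :=
  ((Measure.pi fun _ => uniformOn (Set.univ : Set (Fin p.S))).prod
    (Measure.pi fun _ => Measure.pi fun _ => complexGaussian (p.dS ^ (-p.α1)).toNNReal)).prod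
    p.risLaw

/-! ### Observations -/

/-- The users whose preamble is chosen by nobody else. -/
def granted (s : Fin p.K → Fin p.S) : Finset (Fin p.K) :=
  Finset.univ.filter fun k => ∀ k', s k' = s k → k' = k

def request (w : p.Phase) : p.Request :=
  (p.granted w.1.1, fun k c => if k ∈ p.granted w.1.1 then w.1.2 k c else 0)

/-- The (zero-based) indices of the `2 ^ (Jbar - J)` consecutive reflecting elements that form
subarray number `u` at level `J`. -/
def subarray (J u : ℕ) : Finset (Fin p.M) :=
  Finset.univ.filter fun m =>
    u * 2 ^ (p.Jbar - J) ≤ (m : ℕ) ∧ (m : ℕ) < (u + 1) * 2 ^ (p.Jbar - J)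

/-- The grouped cascaded gains observed by probing with vector `b` at level `J`. -/
def probeObs (J : ℕ) (b : p.Alloc) (z : p.RISGains) : p.ProbeObs := fun c u =>
  match b c with
  | none => 0
  | some k => if (u : ℕ) < 2 ^ J then ∑ m ∈ p.subarray J u, z.1 k c m * z.2 k c m else 0

/-! ### Direct transmission -/

/-- The user/sub-channel pairs of the granted users, in descending order of channel gain. -/
def sortedPairs (x : p.Request) : List (Fin p.K × Fin p.C) :=
  (((List.finRange p.K).product (List.finRange p.C)).filter fun q => decide (q.1 ∈ x.1)).mergeSort
    fun q r => decide (‖x.2 r.1 r.2‖ ≤ ‖x.2 q.1 q.2‖)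

/-- One step of the greedy algorithm: use a pair if neither its sub-channel nor its user has been
used before. -/
def greedyStep (a : p.Alloc) (q : Fin p.K × Fin p.C) : p.Alloc :=
  if a q.2 = none ∧ ∀ c, a c ≠ some q.1 then Function.update a q.2 (some q.1) else a

/-- The schedule found by the greedy algorithm. -/
def greedy (x : p.Request) : p.Alloc :=
  (p.sortedPairs x).foldl p.greedyStep fun _ => none

/-- Sum-rate of the direct links under schedule `a`. -/
def directRate (a : p.Alloc) (x : p.Request) : ℝ :=
  ∑ c, match a c with
    | none => 0
    | some k => Real.logb 2 (1 + p.γ * ‖x.2 k c‖ ^ 2)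

/-- The rate `R_d^*`. -/
def Rd (x : p.Request) : ℝ := p.directRate (p.greedy x) x

/-! ### RIS-aided transmission -/

/-- Optimal reflection coefficient of a subarray with cascaded gain `hu`, when the direct gain is
`hd`. -/
def reflection (hd hu : ℂ) : ℂ :=
  Complex.exp (Complex.I *
    (toIcoMod Real.two_pi_pos 0 (Complex.arg hd - Complex.arg hu) : ℝ))

/-- The RIS-aided sum-rate `R_r(b)` at level `J`, from what is observed before and by probing. -/
def Rr (J : ℕ) (b : p.Alloc) (x : p.Request) (y : p.ProbeObs) : ℝ :=
  ∑ c, match b c with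
    | none => 0
    | some k => Real.logb 2 (1 + p.γ *
        ‖x.2 k c + ∑ u ∈ Finset.univ.filter (fun u : Fin (2 ^ p.Jbar) => (u : ℕ) < 2 ^ J),
          y c u * reflection (x.2 k c) (y c u)‖ ^ 2)

/-! ### Strategies -/

/-- A sequential decision strategy. Phases are numbered from zero. The decisions of phase `n` are
functions of what was observed in the phases before, of the request in phase `n`, and, for `η`, of
what was observed by probing in phase `n`. `ψ = 0` is direct transmission, `ψ = Jbar + 1` is
skipping to the next phase, any other value is the grouping level of a probing phase with probing
vector `φ`; after probing, `η = 0` is RIS-aided transmission and `η = 1` is skipping. -/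
structure Strategy where
  ψ : ∀ n : ℕ, (Fin n → p.Record) × p.Request → Fin (p.Jbar + 2)
  φ : ∀ n : ℕ, (Fin n → p.Record) × p.Request → p.Alloc
  η : ∀ n : ℕ, (Fin n → p.Record) × p.Record → Fin 2
  measurable_ψ : ∀ n, Measurable (ψ n)
  measurable_φ : ∀ n b, MeasurableSet {q | φ n q = b}
  measurable_η : ∀ n, Measurable (η n)
  /-- only granted users can be asked to send pilots -/
  φ_granted : ∀ n q c k, φ n q c = some k → k ∈ q.2.1

/-- `j` is a grouping level. -/
def IsLevel (j : ℕ) : Prop := 1 ≤ j ∧ j ≤ p.Jbar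

namespace Strategy

variable {p}
variable (σ : p.Strategy) (w : ℕ → p.Phase)

open Classical in
/-- The observations in a phase that starts with history `H` and in which nature draws `v`. -/
def record (n : ℕ) (H : Fin n → p.Record) (v : p.Phase) : p.Record :=
  (p.request v,
    if p.IsLevel (σ.ψ n (H, p.request v))
    then p.probeObs (σ.ψ n (H, p.request v)) (σ.φ n (H, p.request v)) v.2
    else 0)

/-- The observations made in the first `n` phases. -/
def history : ∀ n : ℕ, Fin n → p.Record
  | 0 => Fin.elim0
  | n + 1 => Fin.snoc (history n) (σ.record n (history n) (w n))

def psiAt (n : ℕ) : Fin (p.Jbar + 2) := σ.ψ n (σ.history w n, p.request (w n))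

def phiAt (n : ℕ) : p.Alloc := σ.φ n (σ.history w n, p.request (w n))

def etaAt (n : ℕ) : Fin 2 := σ.η n (σ.history w n, σ.record n (σ.history w n) (w n))

/-- Data are transmitted after phase `n` (if not before). -/
def Stops (n : ℕ) : Prop :=
  σ.psiAt w n = 0 ∨ (p.IsLevel (σ.psiAt w n) ∧ σ.etaAt w n = 0)

open Classical in
/-- Traffic volume `Y` when transmitting after phase `n`. -/
def volumeAt (n : ℕ) : ℝ :=
  (if σ.psiAt w n = 0 then p.Rd (p.request (w n)) * p.Tc else 0) +
  (if p.IsLevel (σ.psiAt w n) ∧ σ.etaAt w n = 0 then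
    p.Rr (σ.psiAt w n) (σ.phiAt w n) (p.request (w n))
      (p.probeObs (σ.psiAt w n) (σ.phiAt w n) (w n).2) * (p.Tc - p.τCE (σ.psiAt w n))
   else 0)

open Classical in
/-- Total duration `T` when transmitting after phase `n`. -/
def durationAt (n : ℕ) : ℝ :=
  (n + 1) * p.τRA
    + (∑ l ∈ Finset.range n, if p.IsLevel (σ.psiAt w l) then p.τCE (σ.psiAt w l) else 0)
    + p.Tc

open Classical in
/-- Traffic volume of the frame, `Y_N`; nothing is transmitted if the frame never ends. -/
def frameVolume : ℝ≥0∞ :=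
  if h : ∃ n, σ.Stops w n then ENNReal.ofReal (σ.volumeAt w (Nat.find h)) else 0

open Classical in
/-- Duration of the frame, `T_N`. -/
def frameDuration : ℝ≥0∞ :=
  if h : ∃ n, σ.Stops w n then ENNReal.ofReal (σ.durationAt w (Nat.find h)) else ⊤

end Strategy

/-! ### Throughput -/

section Throughput

variable {p}
variable {Ω : Type*} [MeasurableSpace Ω] (P : Measure Ω) (X : ℕ → Ω → p.Phase)

def meanVolume (σ : p.Strategy) : ℝ≥0∞ := ∫⁻ ω, σ.frameVolume (fun n => X n ω) ∂P

def meanDuration (σ : p.Strategy) : ℝ≥0∞ := ∫⁻ ω, σ.frameDuration (fun n => X n ω) ∂P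

/-- The average throughput of a strategy. -/
def throughput (σ : p.Strategy) : ℝ≥0∞ := meanVolume P X σ / meanDuration P X σ

/-- The maximal throughput: the supremum over all strategies for which the ratio makes sense, that
is, is not a ratio of two infinite expectations. -/
def maxThroughput : ℝ≥0∞ :=
  ⨆ (σ : p.Strategy) (_ : meanVolume P X σ ≠ ⊤ ∨ meanDuration P X σ ≠ ⊤), throughput P X σ

end Throughput

/-! ### The threshold rule -/

/-- The payoff, at price `lam` per unit of time, of probing with vector `b` at level `J` and then
taking the better of the two second-layer options. -/
def probePayoff (b : p.Alloc) (J : ℕ) (lam : ℝ) (x : p.Request) (z : p.RISGains) : ℝ :=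
  max ((p.Tc - p.τCE J) * p.Rr J b x (p.probeObs J b z) - lam * p.Tc) (-lam * p.τCE J)

/-- The threshold function: the mean payoff of probing, given the request. -/
def Θ (b : p.Alloc) (J : ℕ) (lam : ℝ) (x : p.Request) : ℝ :=
  ∫ z, p.probePayoff b J lam x z ∂p.risLaw

/-- The probing options (vector and level) when the set of granted users is `I`. -/
def probes (I : Finset (Fin p.K)) : Set (p.Alloc × ℕ) :=
  {q | (∀ c k, q.1 c = some k → k ∈ I) ∧ p.IsLevel q.2}

/-- The maximum of the threshold function over the (finitely many) probing options. -/
def maxΘ (lam : ℝ) (x : p.Request) : ℝ :=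
  sSup ((fun q : p.Alloc × ℕ => p.Θ q.1 q.2 lam x) '' p.probes x.1)

/-- The value of the best first-layer option at price `lam`. -/
def bestValue (lam : ℝ) (x : p.Request) : ℝ :=
  max (max ((p.Rd x - lam) * p.Tc) 0) (p.maxΘ lam x)

/-- Direct transmission is preferred. -/
def PrefersDirect (lam : ℝ) (x : p.Request) : Prop :=
  max (p.maxΘ lam x) 0 ≤ (p.Rd x - lam) * p.Tc

/-- Skipping to the next phase is preferred. -/
def PrefersSkip (lam : ℝ) (x : p.Request) : Prop :=
  max ((p.Rd x - lam) * p.Tc) (p.maxΘ lam x) < 0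

/-- The strategy follows the two-level threshold rule with threshold `lam`. -/
structure Strategy.FollowsRule {p : Network} (σ : p.Strategy) (lam : ℝ) : Prop where
  direct : ∀ n H x, p.PrefersDirect lam x → σ.ψ n (H, x) = 0
  skip : ∀ n H x, p.PrefersSkip lam x → σ.ψ n (H, x) = Fin.last (p.Jbar + 1)
  probe : ∀ n H x, ¬ p.PrefersDirect lam x → ¬ p.PrefersSkip lam x →
    p.IsLevel (σ.ψ n (H, x)) ∧
    ∀ q ∈ p.probes x.1, p.Θ q.1 q.2 lam x ≤ p.Θ (σ.φ n (H, x)) (σ.ψ n (H, x)) lam x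
  second : ∀ n H x y, ¬ p.PrefersDirect lam x → ¬ p.PrefersSkip lam x →
    (σ.η n (H, (x, y)) = 0 ↔ lam ≤ p.Rr (σ.ψ n (H, x)) (σ.φ n (H, x)) x y)

end Network

end RISAccess

end

/-! ### Law of one phase, measurability of observations and rates, integrable bounds. -/

noncomputable section

namespace RISAccess

/-! Charge a price `lam` for every unit of time. Whatever the history, the largest mean profit that
one phase can bring, before the charge `lam * τRA` for its request, is `meanBest lam`: the
first-layer decision sees only the past and the request, the RIS gains are independent of both, so
probing is worth exactly `Θ`. The function `meanBest` is nonnegative, nonincreasing and Lipschitz,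
hence `meanBest lam = lam * τRA` has exactly one root, and it is nonnegative. At the root no phase
has a positive mean net profit, and under the threshold rule each phase has mean net profit zero
(`lintegral_phaseVolume_le`, `lintegral_phaseVolume_eq`).

Volume and duration of a frame are sums of nonnegative contributions of the phases that are reached.
Whether phase `n` is reached depends on earlier phases only, so independence and Tonelli add up the
one-phase relations (`lintegral_past_present`): every strategy has mean volume at most `lam` times
mean duration, with equality for the rule. Working in `ℝ≥0∞` avoids both optional stopping and
differences of infinite quantities.

Dividing in the case of equality requires a finite mean duration. For `lam > 0`, a phase under the
rule has mean volume at least `lam * τRA`, whereas its volume vanishes unless the phase stops and is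
dominated by one fixed integrable function; so the conditional probability of stopping is bounded
below uniformly (`exists_le_measure_phaseStops`). For `lam = 0` the rule always stops in the first
phase. Hence the root is the maximal throughput and every strategy following the rule attains it. -/

instance isProbabilityMeasure_complexGaussian (v : ℝ≥0) :
    IsProbabilityMeasure (complexGaussian v) := by
  refine Measure.isProbabilityMeasure_map (Measurable.aemeasurable ?_)
  exact Complex.measurableEquivRealProd.symm.measurable

lemma integrable_norm_complexGaussian (v : ℝ≥0) :
    Integrable (fun z : ℂ => ‖z‖) (complexGaussian v) := by
  have hm : Measurable (fun q : ℝ × ℝ => Complex.mk q.1 q.2) :=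
    Complex.measurableEquivRealProd.symm.measurable
  have hg : Integrable (fun r : ℝ => |r|) (gaussianReal 0 (v / 2)) := by
    have := (memLp_id_gaussianReal (μ := 0) (v := v / 2) 1)
    have h := memLp_one_iff_integrable.1 (by simpa using this)
    exact h.abs
  unfold complexGaussian
  rw [integrable_map_measure (by fun_prop) hm.aemeasurable]
  refine ((hg.comp_fst _).add (hg.comp_snd _)).mono' (by fun_prop) ?_
  refine Filter.Eventually.of_forall fun q => ?_
  simpa using Complex.norm_le_abs_re_add_abs_im (Complex.mk q.1 q.2)

/-- All schedules, levels and probing vectors are discrete choices; this reduces measurability of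
what depends on a choice to the case of a fixed choice. -/
lemma measurable_of_countable_fibers {α β ι : Type*} [MeasurableSpace α] [MeasurableSpace β]
    [Countable ι] {s : α → ι} (hs : ∀ i, MeasurableSet {a | s a = i}) {f : ι → α → β}
    (hf : ∀ i, Measurable (f i)) : Measurable fun a => f (s a) a := by
  intro t ht
  have : (fun a => f (s a) a) ⁻¹' t = ⋃ i, {a | s a = i} ∩ f i ⁻¹' t := by ext a; simp
  rw [this]
  exact MeasurableSet.iUnion fun i => (hs i).inter (hf i ht)

namespace Network

variable (p : Network)

/-! ### The law of one phase -/

/-- The law of what is drawn before the request: the preambles and the direct gains. -/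
def directLaw : Measure ((Fin p.K → Fin p.S) × (Fin p.K → Fin p.C → ℂ)) :=
  (Measure.pi fun _ => uniformOn (Set.univ : Set (Fin p.S))).prod
    (Measure.pi fun _ => Measure.pi fun _ => complexGaussian (p.dS ^ (-p.α1)).toNNReal)

lemma phaseLaw_eq : p.phaseLaw = p.directLaw.prod p.risLaw := rfl

instance : IsProbabilityMeasure p.risLaw := by unfold risLaw; infer_instance

instance : IsProbabilityMeasure p.directLaw := by
  have : NeZero p.S := ⟨p.S_pos.ne'⟩
  have : IsProbabilityMeasure (uniformOn (Set.univ : Set (Fin p.S))) :=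
    isProbabilityMeasure_uniformOn Set.finite_univ Set.univ_nonempty
  unfold directLaw; infer_instance

instance : IsProbabilityMeasure p.phaseLaw := by rw [phaseLaw_eq]; infer_instance

/-! ### Measurability -/

lemma measurable_granted : Measurable p.granted := Measurable.of_discrete

lemma measurable_request : Measurable p.request := by
  have h1 : Measurable fun w : p.Phase => p.granted w.1.1 :=
    p.measurable_granted.comp (measurable_fst.comp measurable_fst)
  refine h1.prodMk (measurable_pi_iff.2 fun k => measurable_pi_iff.2 fun c => ?_)
  refine Measurable.ite ?_ (by fun_prop) measurable_const
  exact h1 (MeasurableSet.of_discrete (s := {I : Finset (Fin p.K) | k ∈ I}))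

lemma measurable_probeObs (J : ℕ) (b : p.Alloc) : Measurable (p.probeObs J b) := by
  refine measurable_pi_iff.2 fun c => measurable_pi_iff.2 fun u => ?_
  unfold probeObs
  cases b c with
  | none => exact measurable_const
  | some k =>
    by_cases h : (u : ℕ) < 2 ^ J
    · simp only [h, if_true]; fun_prop
    · simp only [h, if_false]; exact measurable_const

/-- The reduction of the angle modulo `2π` is invisible to the exponential; without it measurability
is immediate. -/
lemma reflection_eq (hd hu : ℂ) :
    reflection hd hu = Complex.exp (Complex.I * ((Complex.arg hd - Complex.arg hu : ℝ) : ℂ)) := by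
  unfold reflection toIcoMod
  rw [Complex.exp_eq_exp_iff_exists_int]
  refine ⟨-toIcoDiv Real.two_pi_pos 0 (Complex.arg hd - Complex.arg hu), ?_⟩
  simp only [zsmul_eq_mul]
  push_cast
  ring

lemma norm_reflection (hd hu : ℂ) : ‖reflection hd hu‖ = 1 := by
  unfold reflection
  rw [mul_comm, Complex.norm_exp_ofReal_mul_I]

lemma measurable_Rr (J : ℕ) (b : p.Alloc) :
    Measurable fun q : p.Request × p.ProbeObs => p.Rr J b q.1 q.2 := by
  unfold Rr
  refine Finset.measurable_fun_sum _ fun c _ => ?_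
  cases b c with
  | none => exact measurable_const
  | some k =>
    simp only [reflection_eq, Real.logb]
    fun_prop

lemma measurable_directRate (a : p.Alloc) : Measurable (p.directRate a) := by
  unfold directRate
  refine Finset.measurable_fun_sum _ fun c _ => ?_
  cases a c with
  | none => exact measurable_const
  | some k =>
    simp only [Real.logb]
    fun_prop

/-- What the greedy algorithm uses of a request: the granted users and the comparisons between
the gains. -/
def comparisons (x : p.Request) :
    Finset (Fin p.K) × (Fin p.K × Fin p.C → Fin p.K × Fin p.C → Bool) :=
  (x.1, fun q r => decide (‖x.2 r.1 r.2‖ ≤ ‖x.2 q.1 q.2‖))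

lemma measurable_comparisons : Measurable p.comparisons := by
  refine measurable_fst.prodMk (measurable_pi_iff.2 fun q => measurable_pi_iff.2 fun r => ?_)
  refine measurable_to_bool ?_
  have : (fun x : p.Request => decide (‖x.2 r.1 r.2‖ ≤ ‖x.2 q.1 q.2‖)) ⁻¹' {true}
      = {x | ‖x.2 r.1 r.2‖ ≤ ‖x.2 q.1 q.2‖} := by ext; simp
  rw [this]
  exact measurableSet_le (by fun_prop) (by fun_prop)

/-- Sorting uses the gains only through pairwise comparisons, so the greedy schedule factors through
a finite discrete space. -/
lemma greedy_eq_comp : ∃ G : _ → p.Alloc, ∀ x, p.greedy x = G (p.comparisons x) :=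
  ⟨fun B : Finset (Fin p.K) × (Fin p.K × Fin p.C → Fin p.K × Fin p.C → Bool) =>
    ((((List.finRange p.K).product (List.finRange p.C)).filter
      fun q => decide (q.1 ∈ B.1)).mergeSort B.2).foldl p.greedyStep fun _ => none, fun _ => rfl⟩

lemma measurableSet_greedy (a : p.Alloc) : MeasurableSet {x | p.greedy x = a} := by
  obtain ⟨G, hG⟩ := p.greedy_eq_comp
  simp only [hG]
  exact p.measurable_comparisons (MeasurableSet.of_discrete (s := {B | G B = a}))

lemma measurable_Rd : Measurable p.Rd :=
  measurable_of_countable_fibers p.measurableSet_greedy p.measurable_directRate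

/-! ### Bounds for the rates -/

lemma γ_pos : 0 < p.γ := div_pos (mul_pos p.Pt_pos p.β0_pos) p.N0_pos

/-- The slope of a linear bound for the rate of one sub-channel. -/
def slope : ℝ := 2 * √p.γ / Real.log 2

lemma slope_nonneg : 0 ≤ p.slope := by unfold slope; positivity

lemma logb_nonneg_of_gain (t : ℝ) : 0 ≤ Real.logb 2 (1 + p.γ * t ^ 2) :=
  Real.logb_nonneg (by norm_num) (by linarith [mul_nonneg p.γ_pos.le (sq_nonneg t)])

/-- From `1 + γ t² ≤ (1 + √γ t)²` and `log (1 + s) ≤ s`. A bound linear in the gain means that first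
moments of the gains suffice for integrability of the rates. -/
lemma logb_le_slope_mul {t : ℝ} (ht : 0 ≤ t) : Real.logb 2 (1 + p.γ * t ^ 2) ≤ p.slope * t := by
  have hs := Real.sqrt_nonneg p.γ
  have hsq := Real.sq_sqrt p.γ_pos.le
  have hst := mul_nonneg hs ht
  have h1 : Real.log (1 + p.γ * t ^ 2) ≤ 2 * (√p.γ * t) := by
    calc Real.log (1 + p.γ * t ^ 2) ≤ Real.log ((1 + √p.γ * t) ^ 2) := by
          refine Real.log_le_log (by have := p.γ_pos; positivity) ?_
          have : (1 + √p.γ * t) ^ 2 = 1 + √p.γ ^ 2 * t ^ 2 + 2 * (√p.γ * t) := by ring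
          rw [this, hsq]; linarith
      _ = 2 * Real.log (1 + √p.γ * t) := by rw [Real.log_pow]; norm_num
      _ ≤ 2 * (√p.γ * t) := by
          have := Real.log_le_sub_one_of_pos (show 0 < 1 + √p.γ * t by positivity)
          linarith
  unfold Real.logb slope
  rw [div_mul_eq_mul_div, mul_assoc]
  exact div_le_div_of_nonneg_right h1 (Real.log_nonneg (by norm_num))

/-- The sum of all direct gains of a request. -/
def directGain (x : p.Request) : ℝ := ∑ c, ∑ k, ‖x.2 k c‖

/-- A bound for the sum of all cascaded gains. -/
def risGain (z : p.RISGains) : ℝ :=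
  ∑ c, ∑ k, (2 : ℝ) ^ p.Jbar * ∑ m, ‖z.1 k c m‖ * ‖z.2 k c m‖

lemma directGain_nonneg (x : p.Request) : 0 ≤ p.directGain x := by unfold directGain; positivity

lemma risGain_nonneg (z : p.RISGains) : 0 ≤ p.risGain z := by unfold risGain; positivity

lemma Rd_nonneg (x : p.Request) : 0 ≤ p.Rd x := by
  unfold Rd directRate
  refine Finset.sum_nonneg fun c _ => ?_
  cases p.greedy x c with
  | none => exact le_rfl
  | some k => exact p.logb_nonneg_of_gain _

lemma Rr_nonneg (J : ℕ) (b : p.Alloc) (x : p.Request) (y : p.ProbeObs) : 0 ≤ p.Rr J b x y := by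
  unfold Rr
  refine Finset.sum_nonneg fun c _ => ?_
  cases b c with
  | none => exact le_rfl
  | some k => exact p.logb_nonneg_of_gain _

lemma Rd_le (x : p.Request) : p.Rd x ≤ p.slope * p.directGain x := by
  unfold Rd directRate directGain
  rw [Finset.mul_sum]
  refine Finset.sum_le_sum fun c _ => ?_
  cases p.greedy x c with
  | none => exact mul_nonneg p.slope_nonneg (by positivity)
  | some k =>
    refine (p.logb_le_slope_mul (norm_nonneg _)).trans
      (mul_le_mul_of_nonneg_left ?_ p.slope_nonneg)
    exact Finset.single_le_sum (f := fun k => ‖x.2 k c‖) (fun _ _ => norm_nonneg _)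
      (Finset.mem_univ k)

lemma norm_probeObs_le (J : ℕ) (b : p.Alloc) (z : p.RISGains) {c : Fin p.C} {k : Fin p.K}
    (h : b c = some k) (u : Fin (2 ^ p.Jbar)) :
    ‖p.probeObs J b z c u‖ ≤ ∑ m, ‖z.1 k c m‖ * ‖z.2 k c m‖ := by
  simp only [probeObs, h]
  split_ifs with hu
  · calc ‖∑ m ∈ p.subarray J u, z.1 k c m * z.2 k c m‖
        ≤ ∑ m ∈ p.subarray J u, ‖z.1 k c m * z.2 k c m‖ := norm_sum_le _ _
      _ ≤ ∑ m, ‖z.1 k c m * z.2 k c m‖ :=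
        Finset.sum_le_sum_of_subset_of_nonneg (Finset.subset_univ _) fun _ _ _ => norm_nonneg _
      _ = _ := by simp
  · simp only [norm_zero]; positivity

lemma Rr_le (J : ℕ) (b : p.Alloc) (x : p.Request) (z : p.RISGains) :
    p.Rr J b x (p.probeObs J b z) ≤ p.slope * (p.directGain x + p.risGain z) := by
  unfold Rr directGain risGain
  rw [← Finset.sum_add_distrib, Finset.mul_sum]
  refine Finset.sum_le_sum fun c _ => ?_
  rw [← Finset.sum_add_distrib]
  cases h : b c with
  | none => exact mul_nonneg p.slope_nonneg (by positivity)
  | some k =>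
    refine (p.logb_le_slope_mul (norm_nonneg _)).trans
      (mul_le_mul_of_nonneg_left ?_ p.slope_nonneg)
    refine le_trans ?_ (Finset.single_le_sum (f := fun k => ‖x.2 k c‖ +
      (2 : ℝ) ^ p.Jbar * ∑ m, ‖z.1 k c m‖ * ‖z.2 k c m‖) (fun _ _ => by positivity)
      (Finset.mem_univ k))
    refine (norm_add_le _ _).trans (add_le_add_right ?_ _)
    calc _ ≤ ∑ u ∈ Finset.univ.filter (fun u : Fin (2 ^ p.Jbar) => (u : ℕ) < 2 ^ J),
          ‖p.probeObs J b z c u * reflection (x.2 k c) (p.probeObs J b z c u)‖ := norm_sum_le _ _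
      _ ≤ ∑ u : Fin (2 ^ p.Jbar),
          ‖p.probeObs J b z c u * reflection (x.2 k c) (p.probeObs J b z c u)‖ :=
        Finset.sum_le_sum_of_subset_of_nonneg (Finset.subset_univ _) fun _ _ _ => norm_nonneg _
      -- Each grouped gain is bounded crudely by the sum over all elements; this is the origin of
      -- the factor `2 ^ Jbar` in `risGain`, and makes the bound independent of `J` and `b`.
      _ ≤ ∑ _u : Fin (2 ^ p.Jbar), ∑ m, ‖z.1 k c m‖ * ‖z.2 k c m‖ := by
        refine Finset.sum_le_sum fun u _ => ?_
        rw [norm_mul, norm_reflection, mul_one]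
        exact p.norm_probeObs_le J b z h u
      _ = _ := by simp

lemma measurable_directGain : Measurable p.directGain := by unfold directGain; fun_prop

lemma integrable_risGain : Integrable p.risGain p.risLaw := by
  unfold risGain
  refine integrable_finsetSum _ fun c _ => integrable_finsetSum _ fun k _ => Integrable.const_mul
    (integrable_finsetSum _ fun m _ => ?_) _
  unfold risLaw
  have (v : ℝ≥0) : Integrable (fun f : Fin p.K → Fin p.C → Fin p.M → ℂ => ‖f k c m‖)
      (Measure.pi fun _ => Measure.pi fun _ => Measure.pi fun _ => complexGaussian v) := by
    have h1 := integrable_comp_eval (X := fun _ : Fin p.M => ℂ) (μ := fun _ => complexGaussian v)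
      (i := m) (integrable_norm_complexGaussian v)
    have h2 := integrable_comp_eval (X := fun _ : Fin p.C => Fin p.M → ℂ)
      (μ := fun _ => Measure.pi fun _ => complexGaussian v) (i := c) h1
    exact integrable_comp_eval (X := fun _ : Fin p.K => Fin p.C → Fin p.M → ℂ)
      (μ := fun _ => Measure.pi fun _ => Measure.pi fun _ => complexGaussian v) (i := k) h2
  -- The two hops are independent, so first moments of each are enough for their product.
  exact (this _).mul_prod (this _)

lemma directGain_request_le (v : p.Phase) :
    p.directGain (p.request v) ≤ ∑ c, ∑ k, ‖v.1.2 k c‖ := by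
  unfold directGain request
  refine Finset.sum_le_sum fun c _ => Finset.sum_le_sum fun k _ => ?_
  dsimp only
  split_ifs <;> simp

lemma integrable_directGain :
    Integrable (fun v => p.directGain (p.request v)) p.phaseLaw := by
  have h : Integrable (fun u : (Fin p.K → Fin p.S) × (Fin p.K → Fin p.C → ℂ) =>
      ∑ c, ∑ k, ‖u.2 k c‖) p.directLaw := by
    refine integrable_finsetSum _ fun c _ => integrable_finsetSum _ fun k _ => ?_
    have h1 : Integrable (fun f : Fin p.K → Fin p.C → ℂ => ‖f k c‖) (Measure.pi fun _ =>
        Measure.pi fun _ => complexGaussian (p.dS ^ (-p.α1)).toNNReal) := by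
      have h2 := integrable_comp_eval (X := fun _ : Fin p.C => ℂ)
        (μ := fun _ => complexGaussian (p.dS ^ (-p.α1)).toNNReal) (i := c)
        (integrable_norm_complexGaussian _)
      exact integrable_comp_eval (X := fun _ : Fin p.K => Fin p.C → ℂ)
        (μ := fun _ => Measure.pi fun _ => complexGaussian (p.dS ^ (-p.α1)).toNNReal) (i := k) h2
    have : NeZero p.S := ⟨p.S_pos.ne'⟩
    have : IsProbabilityMeasure (uniformOn (Set.univ : Set (Fin p.S))) :=
      isProbabilityMeasure_uniformOn Set.finite_univ Set.univ_nonempty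
    exact h1.comp_snd _
  refine (h.comp_fst p.risLaw).mono'
    (p.measurable_directGain.comp p.measurable_request).aestronglyMeasurable
    (Filter.Eventually.of_forall fun v => ?_)
  rw [Real.norm_of_nonneg (p.directGain_nonneg _)]
  exact p.directGain_request_le v

/-- A bound for all rates in a phase. -/
def rateBound (v : p.Phase) : ℝ := p.slope * (p.directGain (p.request v) + p.risGain v.2)

lemma rateBound_nonneg (v : p.Phase) : 0 ≤ p.rateBound v :=
  mul_nonneg p.slope_nonneg (add_nonneg (p.directGain_nonneg _) (p.risGain_nonneg _))

lemma integrable_rateBound : Integrable p.rateBound p.phaseLaw :=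
  (p.integrable_directGain.add (p.integrable_risGain.comp_snd p.directLaw)).const_mul _

lemma Rd_le_rateBound (v : p.Phase) : p.Rd (p.request v) ≤ p.rateBound v :=
  (p.Rd_le _).trans (mul_le_mul_of_nonneg_left (by linarith [p.risGain_nonneg v.2]) p.slope_nonneg)

end Network

end RISAccess

end

/-! ### Value of the options at a given price, the fixed point equation, existence of threshold
strategies. -/

noncomputable section

namespace RISAccess

namespace Network

variable (p : Network)

/-! ### The payoff of probing -/

lemma τCE_pos (J : ℕ) : 0 < p.τCE J := mul_pos (by positivity) p.τs_pos

variable {p} in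
lemma IsLevel.τCE_le {J : ℕ} (h : p.IsLevel J) : p.τCE J ≤ p.Tc :=
  le_trans (mul_le_mul_of_nonneg_right
    (pow_le_pow_right₀ (by norm_num) (Nat.add_le_add_right h.2 1)) p.τs_pos.le) p.probe_fits

lemma measurable_probePayoff (b : p.Alloc) (J : ℕ) (lam : ℝ) :
    Measurable fun q : p.Request × p.RISGains => p.probePayoff b J lam q.1 q.2 := by
  have h := (p.measurable_Rr J b).comp
    (measurable_fst.prodMk ((p.measurable_probeObs J b).comp measurable_snd) :
      Measurable fun q : p.Request × p.RISGains => (q.1, p.probeObs J b q.2))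
  exact ((h.const_mul _).sub_const _).max measurable_const

lemma measurable_probePayoff_request (b : p.Alloc) (J : ℕ) (lam : ℝ) :
    Measurable fun v : p.Phase => p.probePayoff b J lam (p.request v) v.2 := by
  have h := (p.measurable_probePayoff b J lam).comp
    (p.measurable_request.prodMk measurable_snd : Measurable fun v : p.Phase => (p.request v, v.2))
  simpa only [Function.comp_def] using h

variable {p} in
lemma abs_probePayoff_le {J : ℕ} (hJ : p.IsLevel J) (b : p.Alloc) (lam : ℝ)
    (x : p.Request) (z : p.RISGains) :
    |p.probePayoff b J lam x z|
      ≤ p.Tc * (p.slope * (p.directGain x + p.risGain z)) + |lam| * p.Tc := by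
  have h0 := p.Rr_nonneg J b x (p.probeObs J b z)
  have h1 := p.Rr_le J b x z
  have h2 := p.τCE_pos J
  have h3 := hJ.τCE_le
  have h4 : (p.Tc - p.τCE J) * p.Rr J b x (p.probeObs J b z)
      ≤ p.Tc * (p.slope * (p.directGain x + p.risGain z)) :=
    mul_le_mul (by linarith) h1 h0 p.Tc_pos.le
  have h5 : 0 ≤ (p.Tc - p.τCE J) * p.Rr J b x (p.probeObs J b z) :=
    mul_nonneg (by linarith) h0
  refine abs_max_le_max_abs_abs.trans (max_le ?_ ?_)
  · refine (abs_sub _ _).trans (add_le_add ?_ ?_)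
    · rwa [abs_of_nonneg h5]
    · rw [abs_mul, abs_of_pos p.Tc_pos]
  · rw [abs_mul, abs_neg, abs_of_pos h2]
    have := mul_le_mul_of_nonneg_left h3 (abs_nonneg lam)
    linarith

-- Both branches of the maximum are affine in the price with slope at most `Tc` in absolute value.
-- This Lipschitz constant survives integration and maxima and yields continuity of `meanBest`.
variable {p} in
lemma abs_probePayoff_sub_le {J : ℕ} (hJ : p.IsLevel J) (b : p.Alloc) (lam lam' : ℝ)
    (x : p.Request) (z : p.RISGains) :
    |p.probePayoff b J lam x z - p.probePayoff b J lam' x z| ≤ p.Tc * |lam - lam'| := by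
  have h2 := p.τCE_pos J
  have h3 := hJ.τCE_le
  refine (abs_max_sub_max_le_max _ _ _ _).trans (max_le (le_of_eq ?_) ?_)
  · rw [sub_sub_sub_cancel_left, ← sub_mul, abs_mul, abs_of_pos p.Tc_pos, abs_sub_comm, mul_comm]
  · rw [← sub_mul, abs_mul, abs_of_pos h2, neg_sub_neg, abs_sub_comm, mul_comm]
    exact mul_le_mul_of_nonneg_right h3 (abs_nonneg _)

variable {p} in
lemma integrable_probePayoff {J : ℕ} (hJ : p.IsLevel J) (b : p.Alloc) (lam : ℝ) (x : p.Request) :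
    Integrable (p.probePayoff b J lam x) p.risLaw := by
  refine Integrable.mono' ((((integrable_const (p.directGain x)).add
    p.integrable_risGain).const_mul p.slope |>.const_mul p.Tc).add
    (integrable_const (|lam| * p.Tc)))
    ((p.measurable_probePayoff b J lam).comp measurable_prodMk_left).aestronglyMeasurable
    (Filter.Eventually.of_forall fun z => ?_)
  exact abs_probePayoff_le hJ b lam x z

variable {p} in
lemma integrable_probePayoff_request {J : ℕ} (hJ : p.IsLevel J) (b : p.Alloc) (lam : ℝ) :
    Integrable (fun v : p.Phase => p.probePayoff b J lam (p.request v) v.2) p.phaseLaw := by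
  refine Integrable.mono' ((p.integrable_rateBound.const_mul p.Tc).add
    (integrable_const (|lam| * p.Tc)))
    (p.measurable_probePayoff_request b J lam).aestronglyMeasurable
    (Filter.Eventually.of_forall fun v => ?_)
  exact abs_probePayoff_le hJ b lam (p.request v) v.2
lemma probePayoff_antitone (b : p.Alloc) (J : ℕ) (x : p.Request) (z : p.RISGains) :
    Antitone fun lam => p.probePayoff b J lam x z := fun _ _ h =>
  max_le_max (sub_le_sub_left (mul_le_mul_of_nonneg_right h p.Tc_pos.le) _)
    (mul_le_mul_of_nonneg_right (neg_le_neg h) (p.τCE_pos J).le)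

/-! ### The threshold function -/

lemma measurable_Θ (b : p.Alloc) (J : ℕ) (lam : ℝ) : Measurable (p.Θ b J lam) :=
  (StronglyMeasurable.integral_prod_right'
    (p.measurable_probePayoff b J lam).stronglyMeasurable).measurable

variable {p} in
lemma abs_Θ_le {J : ℕ} (hJ : p.IsLevel J) (b : p.Alloc) (lam : ℝ) (x : p.Request) :
    |p.Θ b J lam x| ≤ p.Tc * (p.slope * (p.directGain x + ∫ z, p.risGain z ∂p.risLaw))
      + |lam| * p.Tc := by
  have h1 : Integrable (fun z => p.directGain x + p.risGain z) p.risLaw :=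
    (integrable_const _).add p.integrable_risGain
  have h2 : Integrable (fun z => p.Tc * (p.slope * (p.directGain x + p.risGain z))) p.risLaw :=
    (h1.const_mul _).const_mul _
  calc |p.Θ b J lam x| ≤ ∫ z, |p.probePayoff b J lam x z| ∂p.risLaw := abs_integral_le_integral_abs
    _ ≤ ∫ z, (p.Tc * (p.slope * (p.directGain x + p.risGain z)) + |lam| * p.Tc) ∂p.risLaw :=
      integral_mono (integrable_probePayoff hJ b lam x).abs (h2.add (integrable_const _))
        fun z => abs_probePayoff_le hJ b lam x z
    _ = _ := by
      rw [integral_add h2 (integrable_const _), integral_const_mul, integral_const_mul,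
        integral_add (integrable_const _) p.integrable_risGain]
      simp

variable {p} in
lemma abs_Θ_sub_le {J : ℕ} (hJ : p.IsLevel J) (b : p.Alloc) (lam lam' : ℝ) (x : p.Request) :
    |p.Θ b J lam x - p.Θ b J lam' x| ≤ p.Tc * |lam - lam'| := by
  have h1 := integrable_probePayoff hJ b lam x
  have h2 := integrable_probePayoff hJ b lam' x
  unfold Θ
  rw [← integral_sub h1 h2]
  calc _ ≤ ∫ z, |p.probePayoff b J lam x z - p.probePayoff b J lam' x z| ∂p.risLaw :=
        abs_integral_le_integral_abs
    _ ≤ ∫ _z, p.Tc * |lam - lam'| ∂p.risLaw :=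
        integral_mono (h1.sub h2).abs (integrable_const _)
          fun z => abs_probePayoff_sub_le hJ b lam lam' x z
    _ = _ := by simp

variable {p} in
lemma Θ_antitone {J : ℕ} (hJ : p.IsLevel J) (b : p.Alloc) (x : p.Request) :
    Antitone fun lam => p.Θ b J lam x := fun lam lam' h =>
  integral_mono (integrable_probePayoff hJ b lam' x) (integrable_probePayoff hJ b lam x)
    fun z => p.probePayoff_antitone b J x z h
lemma finite_probes (I : Finset (Fin p.K)) : (p.probes I).Finite := by
  refine ((Set.finite_univ (α := p.Alloc)).prod (Set.finite_Icc 1 p.Jbar)).subset ?_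
  rintro ⟨b, J⟩ ⟨-, h⟩
  exact ⟨trivial, h⟩

/-- Together with finiteness this makes the `sSup` in `maxΘ` an attained maximum. Probing no
sub-channel at level 1 is allowed even when nobody is granted. -/
lemma nonempty_probes (I : Finset (Fin p.K)) : (p.probes I).Nonempty :=
  ⟨(fun _ => none, 1), by simp, le_rfl, p.Jbar_pos⟩

lemma Θ_le_maxΘ {lam : ℝ} {x : p.Request} {q : p.Alloc × ℕ} (hq : q ∈ p.probes x.1) :
    p.Θ q.1 q.2 lam x ≤ p.maxΘ lam x :=
  le_csSup ((p.finite_probes x.1).image _).bddAbove ⟨q, hq, rfl⟩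

lemma exists_Θ_eq_maxΘ (lam : ℝ) (x : p.Request) :
    ∃ q ∈ p.probes x.1, p.Θ q.1 q.2 lam x = p.maxΘ lam x :=
  ((p.nonempty_probes x.1).image _).csSup_mem ((p.finite_probes x.1).image _)

lemma measurableSet_mem_probes (q : p.Alloc × ℕ) :
    MeasurableSet {x : p.Request | q ∈ p.probes x.1} :=
  measurable_fst (MeasurableSet.of_discrete (s := {I : Finset (Fin p.K) | q ∈ p.probes I}))

/-- The set of options varies with the request, so superlevel sets are written as a countable union
over all conceivable options, each cut down to the requests that allow it. -/
lemma measurable_maxΘ (lam : ℝ) : Measurable (p.maxΘ lam) := by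
  refine measurable_of_Ici fun a => ?_
  have : p.maxΘ lam ⁻¹' Set.Ici a
      = ⋃ q : p.Alloc × ℕ, {x | q ∈ p.probes x.1} ∩ {x | a ≤ p.Θ q.1 q.2 lam x} := by
    ext x
    simp only [Set.mem_preimage, Set.mem_Ici, Set.mem_iUnion, Set.mem_inter_iff, Set.mem_ofPred_eq]
    constructor
    · intro h
      obtain ⟨q, hq, hqe⟩ := p.exists_Θ_eq_maxΘ lam x
      exact ⟨q, hq, hqe ▸ h⟩
    · rintro ⟨q, hq, h⟩
      exact h.trans (p.Θ_le_maxΘ hq)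
  rw [this]
  exact MeasurableSet.iUnion fun q => (p.measurableSet_mem_probes q).inter
    (measurableSet_le measurable_const (p.measurable_Θ _ _ _))

lemma abs_maxΘ_le (lam : ℝ) (x : p.Request) :
    |p.maxΘ lam x| ≤ p.Tc * (p.slope * (p.directGain x + ∫ z, p.risGain z ∂p.risLaw))
      + |lam| * p.Tc := by
  obtain ⟨q, hq, hqe⟩ := p.exists_Θ_eq_maxΘ lam x
  rw [← hqe]
  exact abs_Θ_le hq.2 q.1 lam x

/-- The maximizer for one price is a competitor for the other. -/
lemma abs_maxΘ_sub_le (lam lam' : ℝ) (x : p.Request) :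
    |p.maxΘ lam x - p.maxΘ lam' x| ≤ p.Tc * |lam - lam'| := by
  obtain ⟨q, hq, hqe⟩ := p.exists_Θ_eq_maxΘ lam x
  obtain ⟨r, hr, hre⟩ := p.exists_Θ_eq_maxΘ lam' x
  have h1 := p.Θ_le_maxΘ (lam := lam') hq
  have h2 := p.Θ_le_maxΘ (lam := lam) hr
  have h3 := abs_le.1 (abs_Θ_sub_le hq.2 q.1 lam lam' x)
  have h4 := abs_le.1 (abs_Θ_sub_le hr.2 r.1 lam lam' x)
  exact abs_le.2 ⟨by linarith [h4.1], by linarith [h3.2]⟩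

lemma maxΘ_antitone (x : p.Request) : Antitone fun lam => p.maxΘ lam x := fun lam lam' h => by
  obtain ⟨q, hq, hqe⟩ := p.exists_Θ_eq_maxΘ lam' x
  exact hqe.symm.le.trans ((Θ_antitone hq.2 q.1 x h).trans (p.Θ_le_maxΘ hq))

/-! ### The value of the best option -/

lemma bestValue_nonneg (lam : ℝ) (x : p.Request) : 0 ≤ p.bestValue lam x :=
  (le_max_right _ _).trans (le_max_left _ _)

lemma measurable_bestValue (lam : ℝ) : Measurable (p.bestValue lam) :=
  (((p.measurable_Rd.sub_const _).mul_const _).max measurable_const).max (p.measurable_maxΘ lam)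

lemma bestValue_antitone (x : p.Request) : Antitone fun lam => p.bestValue lam x :=
  fun _ _ h => max_le_max (max_le_max
    (mul_le_mul_of_nonneg_right (sub_le_sub_left h _) p.Tc_pos.le) le_rfl) (p.maxΘ_antitone x h)

lemma abs_bestValue_sub_le (lam lam' : ℝ) (x : p.Request) :
    |p.bestValue lam x - p.bestValue lam' x| ≤ p.Tc * |lam - lam'| := by
  have h0 : 0 ≤ p.Tc * |lam - lam'| := mul_nonneg p.Tc_pos.le (abs_nonneg _)
  refine (abs_max_sub_max_le_max _ _ _ _).trans (max_le ?_ (p.abs_maxΘ_sub_le lam lam' x))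
  refine (abs_max_sub_max_le_max _ _ _ _).trans (max_le (le_of_eq ?_) (by simpa using h0))
  rw [← sub_mul, sub_sub_sub_cancel_left, abs_mul, abs_of_pos p.Tc_pos, abs_sub_comm, mul_comm]

lemma bestValue_le (lam : ℝ) (x : p.Request) :
    p.bestValue lam x ≤ p.Tc * (p.slope * (p.directGain x + ∫ z, p.risGain z ∂p.risLaw))
      + |lam| * p.Tc := by
  have h1 := p.directGain_nonneg x
  have h2 : 0 ≤ ∫ z, p.risGain z ∂p.risLaw := integral_nonneg p.risGain_nonneg
  have h3 := p.slope_nonneg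
  have h4 := p.Tc_pos
  refine max_le (max_le ?_ (by positivity)) ((le_abs_self _).trans (p.abs_maxΘ_le lam x))
  have h5 : p.Rd x ≤ p.slope * (p.directGain x + ∫ z, p.risGain z ∂p.risLaw) :=
    (p.Rd_le x).trans (mul_le_mul_of_nonneg_left (by linarith) h3)
  have h6 := neg_le_abs lam
  nlinarith

lemma integrable_bestValue (lam : ℝ) :
    Integrable (fun v => p.bestValue lam (p.request v)) p.phaseLaw := by
  refine Integrable.mono' ((((p.integrable_directGain.add
    (integrable_const (∫ z, p.risGain z ∂p.risLaw))).const_mul p.slope).const_mul p.Tc).add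
    (integrable_const (|lam| * p.Tc)))
    ((p.measurable_bestValue lam).comp p.measurable_request).aestronglyMeasurable
    (Filter.Eventually.of_forall fun v => ?_)
  rw [Real.norm_of_nonneg (p.bestValue_nonneg _ _)]
  exact p.bestValue_le lam (p.request v)

/-- The mean value of the best option in a phase, at price `lam`. -/
def meanBest (lam : ℝ) : ℝ := ∫ v, p.bestValue lam (p.request v) ∂p.phaseLaw

lemma meanBest_nonneg (lam : ℝ) : 0 ≤ p.meanBest lam :=
  integral_nonneg fun _ => p.bestValue_nonneg _ _

lemma meanBest_antitone : Antitone p.meanBest := fun lam lam' h =>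
  integral_mono (p.integrable_bestValue lam') (p.integrable_bestValue lam)
    fun v => p.bestValue_antitone (p.request v) h

lemma abs_meanBest_sub_le (lam lam' : ℝ) :
    |p.meanBest lam - p.meanBest lam'| ≤ p.Tc * |lam - lam'| := by
  have h1 := p.integrable_bestValue lam
  have h2 := p.integrable_bestValue lam'
  unfold meanBest
  rw [← integral_sub h1 h2]
  calc _ ≤ ∫ v, |p.bestValue lam (p.request v) - p.bestValue lam' (p.request v)| ∂p.phaseLaw :=
        abs_integral_le_integral_abs
    _ ≤ ∫ _v, p.Tc * |lam - lam'| ∂p.phaseLaw :=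
        integral_mono (h1.sub h2).abs (integrable_const _)
          fun v => p.abs_bestValue_sub_le lam lam' (p.request v)
    _ = _ := by simp

lemma continuous_meanBest : Continuous p.meanBest :=
  (LipschitzWith.of_dist_le_mul (K := p.Tc.toNNReal) fun a b => by
    rw [Real.dist_eq, Real.dist_eq, Real.coe_toNNReal _ p.Tc_pos.le]
    exact p.abs_meanBest_sub_le a b).continuous

/-- Intermediate value theorem on `[0, meanBest 0 / τRA]`: at the right end `lam * τRA` equals
`meanBest 0`, which dominates `meanBest lam` by monotonicity. -/
lemma exists_meanBest_eq : ∃ lam, 0 ≤ lam ∧ p.meanBest lam = lam * p.τRA := by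
  have h0 := p.meanBest_nonneg 0
  have hA : 0 ≤ p.meanBest 0 / p.τRA := div_nonneg h0 p.τRA_pos.le
  have hc : ContinuousOn (fun lam => p.meanBest lam - lam * p.τRA)
      (Set.Icc 0 (p.meanBest 0 / p.τRA)) :=
    (p.continuous_meanBest.sub (continuous_id.mul continuous_const)).continuousOn
  have hmem : (0 : ℝ) ∈ Set.Icc
      (p.meanBest (p.meanBest 0 / p.τRA) - p.meanBest 0 / p.τRA * p.τRA)
      (p.meanBest 0 - 0 * p.τRA) := by
    rw [div_mul_cancel₀ _ p.τRA_pos.ne']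
    exact ⟨by linarith [p.meanBest_antitone hA], by simpa using h0⟩
  obtain ⟨lam, h1, h2⟩ := intermediate_value_Icc' hA hc hmem
  exact ⟨lam, h1.1, sub_eq_zero.1 h2⟩

/-- The left side of the equation is nonincreasing in the price, the right side strictly increasing.
-/
lemma meanBest_eq_unique {lam lam' : ℝ} (h : p.meanBest lam = lam * p.τRA)
    (h' : p.meanBest lam' = lam' * p.τRA) : lam = lam' := by
  have ht := p.τRA_pos
  rcases le_total lam lam' with hl | hl <;> have := p.meanBest_antitone hl <;> nlinarith

/-! ### The threshold function as a conditional expectation -/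

section

variable {p} {Ω : Type*} [MeasurableSpace Ω] {P : Measure Ω} [IsProbabilityMeasure P]

/-- The request is a function of the first factor of the product law, so integrating out the RIS
gains with the request frozen gives the conditional expectation. -/
lemma condExp_probePayoff {Z : Ω → p.Phase} (hZ : Measurable Z) (hlaw : P.map Z = p.phaseLaw)
    {J : ℕ} (hJ : p.IsLevel J) (b : p.Alloc) (lam : ℝ) :
    Integrable (fun ω => p.probePayoff b J lam (p.request (Z ω)) (Z ω).2) P ∧
    P[fun ω => p.probePayoff b J lam (p.request (Z ω)) (Z ω).2 |
        MeasurableSpace.comap (fun ω => p.request (Z ω)) inferInstance]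
      =ᵐ[P] fun ω => p.Θ b J lam (p.request (Z ω)) := by
  have hi := integrable_probePayoff_request hJ b lam
  have hΘm : Measurable fun v => p.Θ b J lam (p.request v) :=
    (p.measurable_Θ b J lam).comp p.measurable_request
  have hΘ : Integrable (fun v => p.Θ b J lam (p.request v)) p.phaseLaw := by
    refine Integrable.mono' ((((p.integrable_directGain.add
      (integrable_const (∫ z, p.risGain z ∂p.risLaw))).const_mul p.slope).const_mul p.Tc).add
      (integrable_const (|lam| * p.Tc))) hΘm.aestronglyMeasurable
      (Filter.Eventually.of_forall fun v => ?_)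
    exact abs_Θ_le hJ b lam (p.request v)
  have hrZ : Measurable fun ω => p.request (Z ω) := p.measurable_request.comp hZ
  have hiZ : Integrable (fun ω => p.probePayoff b J lam (p.request (Z ω)) (Z ω).2) P := by
    rw [← hlaw] at hi
    exact hi.comp_measurable hZ
  have hΘZ : Integrable (fun ω => p.Θ b J lam (p.request (Z ω))) P := by
    rw [← hlaw] at hΘ
    exact hΘ.comp_measurable hZ
  refine ⟨hiZ, (ae_eq_condExp_of_forall_setIntegral_eq hrZ.comap_le hiZ
    (fun s _ _ => hΘZ.integrableOn) ?_ ?_).symm⟩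
  · rintro s ⟨B, hB, rfl⟩ -
    have hS : MeasurableSet (p.request ⁻¹' B) := p.measurable_request hB
    have key : ∀ f : p.Phase → ℝ, Integrable f p.phaseLaw →
        ∫ ω in (fun ω => p.request (Z ω)) ⁻¹' B, f (Z ω) ∂P
          = ∫ u, ∫ z, (p.request ⁻¹' B).indicator f (u, z) ∂p.risLaw ∂p.directLaw := by
      intro f hf
      have h := integral_prod (μ := p.directLaw) (ν := p.risLaw)
        (fun v => (p.request ⁻¹' B).indicator f v) (hf.indicator hS)
      rw [← h, integral_indicator hS, ← phaseLaw_eq, ← hlaw,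
        setIntegral_map hS (hlaw ▸ hf.aestronglyMeasurable) hZ.aemeasurable]
      rfl
    rw [key _ hΘ, key _ hi]
    refine integral_congr_ae (Filter.Eventually.of_forall fun u => ?_)
    have hr : ∀ z z', p.request (u, z) = p.request (u, z') := fun _ _ => rfl
    by_cases hu : p.request (u, 0) ∈ B
    · have hz : ∀ z, (u, z) ∈ p.request ⁻¹' B := fun z => hu
      simp only [Set.indicator_of_mem (hz _)]
      simp only [hr _ 0]
      simp [Θ]
    · have hz : ∀ z, (u, z) ∉ p.request ⁻¹' B := fun z => hu
      simp only [Set.indicator_of_notMem (hz _)]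
  · exact ((p.measurable_Θ b J lam).comp
      (comap_measurable (fun ω => p.request (Z ω)))).stronglyMeasurable.aestronglyMeasurable

end

/-! ### Existence of threshold strategies -/

/-- Enumerate the countably many options and take the first maximizer in this enumeration: breaking
ties by index makes the selection measurable. -/
lemma exists_measurable_maximizer (lam : ℝ) : ∃ sel : p.Request → p.Alloc × ℕ,
    (∀ q, MeasurableSet {x | sel x = q}) ∧
    ∀ x, sel x ∈ p.probes x.1 ∧ p.Θ (sel x).1 (sel x).2 lam x = p.maxΘ lam x := by
  classical
  obtain ⟨e, he⟩ := exists_surjective_nat (p.Alloc × ℕ)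
  have hex : ∀ x : p.Request, ∃ n, e n ∈ p.probes x.1 ∧
      p.Θ (e n).1 (e n).2 lam x = p.maxΘ lam x := fun x => by
    obtain ⟨q, hq⟩ := p.exists_Θ_eq_maxΘ lam x
    obtain ⟨n, rfl⟩ := he q
    exact ⟨n, hq⟩
  have hm : Measurable fun x => Nat.find (hex x) := measurable_find hex fun n =>
    (p.measurableSet_mem_probes _).inter
      (measurableSet_eq_fun (p.measurable_Θ _ _ _) (p.measurable_maxΘ lam))
  exact ⟨fun x => e (Nat.find (hex x)), fun q =>
    hm (MeasurableSet.of_discrete (s := {n | e n = q})),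
    fun x => Nat.find_spec (hex x)⟩

lemma measurableSet_prefersDirect (lam : ℝ) : MeasurableSet {x | p.PrefersDirect lam x} :=
  measurableSet_le ((p.measurable_maxΘ lam).max measurable_const)
    ((p.measurable_Rd.sub_const _).mul_const _)

lemma measurableSet_prefersSkip (lam : ℝ) : MeasurableSet {x | p.PrefersSkip lam x} :=
  measurableSet_lt (((p.measurable_Rd.sub_const _).mul_const _).max (p.measurable_maxΘ lam))
    measurable_const

variable {p} in
lemma PrefersSkip.not_prefersDirect {lam : ℝ} {x : p.Request} (h : p.PrefersSkip lam x) :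
    ¬ p.PrefersDirect lam x := fun h' =>
  absurd ((le_max_right _ _).trans (h'.trans (le_max_left _ (p.maxΘ lam x)))) (not_le.2 h)

open Classical in
lemma exists_followsRule (lam : ℝ) : ∃ σ : p.Strategy, σ.FollowsRule lam := by
  obtain ⟨sel, hsm, hsel⟩ := p.exists_measurable_maximizer lam
  -- A level is at most `Jbar`, so encoding it in `Fin (Jbar + 2)` does not wrap around.
  have hlvl : ∀ x, ((Fin.ofNat (p.Jbar + 2) (sel x).2 : Fin (p.Jbar + 2)) : ℕ) = (sel x).2 :=
    fun x => Nat.mod_eq_of_lt (by have := (hsel x).1.2.2; omega)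
  have hRr : MeasurableSet
      {r : p.Record | lam ≤ p.Rr (sel r.1).2 (sel r.1).1 r.1 r.2} :=
    measurableSet_le measurable_const (measurable_of_countable_fibers
      (s := fun r : p.Record => sel r.1) (f := fun q r => p.Rr q.2 q.1 r.1 r.2)
      (fun q => measurable_fst (hsm q)) fun q => p.measurable_Rr _ _)
  have hsel2 : Measurable fun x => (Fin.ofNat (p.Jbar + 2) (sel x).2 : Fin (p.Jbar + 2)) :=
    measurable_of_countable_fibers (f := fun (q : p.Alloc × ℕ) _ => Fin.ofNat (p.Jbar + 2) q.2)
      hsm fun _ => measurable_const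
  let σ : p.Strategy :=
    { ψ := fun _ q => if p.PrefersDirect lam q.2 then 0 else
        if p.PrefersSkip lam q.2 then Fin.last (p.Jbar + 1)
        else Fin.ofNat (p.Jbar + 2) (sel q.2).2
      φ := fun _ q => (sel q.2).1
      η := fun _ r => if lam ≤ p.Rr (sel r.2.1).2 (sel r.2.1).1 r.2.1 r.2.2 then 0 else 1
      measurable_ψ := fun _ => Measurable.ite (measurable_snd (p.measurableSet_prefersDirect lam))
        measurable_const (Measurable.ite (measurable_snd (p.measurableSet_prefersSkip lam))
          measurable_const (hsel2.comp measurable_snd))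
      measurable_φ := fun n b => by
        have : {q : (Fin n → p.Record) × p.Request | (sel q.2).1 = b}
            = ⋃ J : ℕ, {q | sel q.2 = (b, J)} := by
          ext q; simp [Prod.ext_iff]
        rw [this]
        exact MeasurableSet.iUnion fun J => measurable_snd (hsm (b, J))
      measurable_η := fun _ => Measurable.ite (measurable_snd hRr)
        measurable_const measurable_const
      φ_granted := fun _ q c k h => (hsel q.2).1.1 c k h }
  have hψ : ∀ n H x, ¬ p.PrefersDirect lam x → ¬ p.PrefersSkip lam x →
      (σ.ψ n (H, x) : ℕ) = (sel x).2 := fun n H x h1 h2 => by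
    simp only [σ, if_neg h1, if_neg h2, hlvl]
  refine ⟨σ, ⟨fun n H x h => if_pos h, fun n H x h => ?_, fun n H x h1 h2 => ?_,
    fun n H x y h1 h2 => ?_⟩⟩
  · simp only [σ, if_neg h.not_prefersDirect, if_pos h]
  · rw [hψ n H x h1 h2]
    exact ⟨(hsel x).1.2, fun q hq => (p.Θ_le_maxΘ hq).trans (hsel x).2.symm.le⟩
  · rw [hψ n H x h1 h2]
    simp only [σ]
    split_ifs with h <;> simp [h]

end Network

end RISAccess

end

/-! ### Mean profit and stopping probability of one phase, given its history. -/

noncomputable section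

namespace RISAccess

namespace Network

variable {p : Network}

lemma IsLevel.ne_zero {j : Fin (p.Jbar + 2)} (h : p.IsLevel j) : j ≠ 0 := by
  rintro rfl
  exact absurd h.1 (by simp)

lemma not_isLevel_zero : ¬ p.IsLevel ((0 : Fin (p.Jbar + 2)) : ℕ) := fun h => h.ne_zero rfl

lemma not_isLevel_last : ¬ p.IsLevel (Fin.last (p.Jbar + 1) : ℕ) := fun h => by
  have := h.2
  simp at this

lemma bestValue_of_prefersDirect {lam : ℝ} {x : p.Request} (h : p.PrefersDirect lam x) :
    p.bestValue lam x = (p.Rd x - lam) * p.Tc := by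
  have h1 := max_le_iff.1 h
  unfold bestValue
  rw [max_eq_left h1.2, max_eq_left h1.1]

lemma bestValue_of_prefersSkip {lam : ℝ} {x : p.Request} (h : p.PrefersSkip lam x) :
    p.bestValue lam x = 0 := by
  have h1 := max_lt_iff.1 h
  unfold bestValue
  rw [max_eq_right h1.1.le, max_eq_left h1.2.le]

/-- Rejecting both other options forces `0 ≤ maxΘ`: if `maxΘ` were negative, rejecting direct
transmission would make its payoff negative too, and skipping would be preferred. -/
lemma bestValue_of_probe {lam : ℝ} {x : p.Request} (h1 : ¬ p.PrefersDirect lam x)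
    (h2 : ¬ p.PrefersSkip lam x) : p.bestValue lam x = p.maxΘ lam x := by
  have h1 : (p.Rd x - lam) * p.Tc < max (p.maxΘ lam x) 0 := not_le.1 h1
  have h2 : 0 ≤ max ((p.Rd x - lam) * p.Tc) (p.maxΘ lam x) := not_lt.1 h2
  unfold bestValue
  have h3 : 0 ≤ p.maxΘ lam x := by
    by_contra! h
    rw [max_eq_right h.le] at h1
    exact absurd h2 (not_le.2 (max_lt h1 h))
  rw [max_eq_left h3] at h1
  exact max_eq_right (max_le h1.le h3)

namespace Strategy

variable (σ : p.Strategy)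

/-! ### One phase with a given history -/

/-- Data are transmitted after a phase with history `H` in which nature draws `v`. -/
def PhaseStops (n : ℕ) (H : Fin n → p.Record) (v : p.Phase) : Prop :=
  σ.ψ n (H, p.request v) = 0 ∨
    (p.IsLevel (σ.ψ n (H, p.request v)) ∧ σ.η n (H, σ.record n H v) = 0)

open Classical in
/-- The volume transmitted directly after a phase. -/
def phaseVolume (n : ℕ) (H : Fin n → p.Record) (v : p.Phase) : ℝ :=
  (if σ.ψ n (H, p.request v) = 0 then p.Rd (p.request v) * p.Tc else 0) +
  (if p.IsLevel (σ.ψ n (H, p.request v)) ∧ σ.η n (H, σ.record n H v) = 0 then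
    p.Rr (σ.ψ n (H, p.request v)) (σ.φ n (H, p.request v)) (p.request v)
      (p.probeObs (σ.ψ n (H, p.request v)) (σ.φ n (H, p.request v)) v.2)
      * (p.Tc - p.τCE (σ.ψ n (H, p.request v)))
   else 0)

open Classical in
/-- The contribution of a phase to the duration of the frame. -/
def phaseTime (n : ℕ) (H : Fin n → p.Record) (v : p.Phase) : ℝ :=
  p.τRA + if σ.PhaseStops n H v then p.Tc else
    if p.IsLevel (σ.ψ n (H, p.request v)) then p.τCE (σ.ψ n (H, p.request v)) else 0

open Classical in
/-- The payoff of a phase if the better second-layer option is chosen after probing. -/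
def choiceValue (lam : ℝ) (n : ℕ) (H : Fin n → p.Record) (v : p.Phase) : ℝ :=
  if σ.ψ n (H, p.request v) = 0 then (p.Rd (p.request v) - lam) * p.Tc else
    if p.IsLevel (σ.ψ n (H, p.request v)) then
      p.probePayoff (σ.φ n (H, p.request v)) (σ.ψ n (H, p.request v)) lam (p.request v) v.2
    else 0

section Measurability

variable (n : ℕ)

lemma measurableSet_choice (i : Fin (p.Jbar + 2) × p.Alloc) :
    MeasurableSet {q : (Fin n → p.Record) × p.Phase |
      (σ.ψ n (q.1, p.request q.2), σ.φ n (q.1, p.request q.2)) = i} := by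
  have hm : Measurable fun q : (Fin n → p.Record) × p.Phase => (q.1, p.request q.2) :=
    measurable_fst.prodMk (p.measurable_request.comp measurable_snd)
  simp only [Prod.ext_iff]
  exact (((σ.measurable_ψ n).comp hm) (measurableSet_singleton i.1)).inter
    (hm (σ.measurable_φ n i.2))

open Classical in
lemma measurable_record :
    Measurable fun q : (Fin n → p.Record) × p.Phase => σ.record n q.1 q.2 := by
  refine (p.measurable_request.comp measurable_snd).prodMk
    (measurable_of_countable_fibers (σ.measurableSet_choice n)
      (f := fun i q => if p.IsLevel i.1 then p.probeObs i.1 i.2 q.2.2 else 0) fun i => ?_)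
  by_cases h : p.IsLevel i.1
  · simp only [h, if_true]
    exact (p.measurable_probeObs i.1 i.2).comp (measurable_snd.comp measurable_snd)
  · simp only [h, if_false]
    exact measurable_const

lemma measurableSet_transmits :
    MeasurableSet {q : (Fin n → p.Record) × p.Phase | σ.η n (q.1, σ.record n q.1 q.2) = 0} :=
  (((σ.measurable_η n).comp (measurable_fst.prodMk (σ.measurable_record n))))
    (measurableSet_singleton 0)

lemma measurableSet_level (s : Set (Fin (p.Jbar + 2))) :
    MeasurableSet {q : (Fin n → p.Record) × p.Phase | σ.ψ n (q.1, p.request q.2) ∈ s} :=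
  ((σ.measurable_ψ n).comp (measurable_fst.prodMk (p.measurable_request.comp measurable_snd)))
    (MeasurableSet.of_discrete (s := s))

lemma measurableSet_phaseStops :
    MeasurableSet {q : (Fin n → p.Record) × p.Phase | σ.PhaseStops n q.1 q.2} :=
  (σ.measurableSet_level n {0}).union
    ((σ.measurableSet_level n {j | p.IsLevel j}).inter (σ.measurableSet_transmits n))

open Classical in
lemma measurable_phaseVolume :
    Measurable fun q : (Fin n → p.Record) × p.Phase => σ.phaseVolume n q.1 q.2 := by
  refine Measurable.add (Measurable.ite (σ.measurableSet_level n {0})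
    ((p.measurable_Rd.comp (p.measurable_request.comp measurable_snd)).mul_const _)
    measurable_const) (Measurable.ite ((σ.measurableSet_level n {j | p.IsLevel j}).inter
      (σ.measurableSet_transmits n)) ?_ measurable_const)
  refine measurable_of_countable_fibers (σ.measurableSet_choice n)
    (f := fun i q => p.Rr i.1 i.2 (p.request q.2) (p.probeObs i.1 i.2 q.2.2)
      * (p.Tc - p.τCE i.1)) fun i => ?_
  exact ((p.measurable_Rr i.1 i.2).comp ((p.measurable_request.comp measurable_snd).prodMk
    ((p.measurable_probeObs i.1 i.2).comp (measurable_snd.comp measurable_snd)))).mul_const _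

open Classical in
lemma measurable_phaseTime :
    Measurable fun q : (Fin n → p.Record) × p.Phase => σ.phaseTime n q.1 q.2 := by
  refine (Measurable.ite (σ.measurableSet_phaseStops n) measurable_const
    (Measurable.ite (σ.measurableSet_level n {j | p.IsLevel j}) ?_ measurable_const)).const_add _
  exact measurable_of_countable_fibers (σ.measurableSet_choice n)
    (f := fun i _ => p.τCE i.1) fun i => measurable_const

open Classical in
lemma measurable_choiceValue (lam : ℝ) :
    Measurable fun q : (Fin n → p.Record) × p.Phase => σ.choiceValue lam n q.1 q.2 := by
  have h0 : Measurable fun q : (Fin n → p.Record) × p.Phase =>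
      (p.Rd (p.request q.2) - lam) * p.Tc :=
    ((p.measurable_Rd.comp (p.measurable_request.comp measurable_snd)).sub_const _).mul_const _
  have h1 (i : Fin (p.Jbar + 2) × p.Alloc) : Measurable fun q : (Fin n → p.Record) × p.Phase =>
      p.probePayoff i.2 i.1 lam (p.request q.2) q.2.2 :=
    (p.measurable_probePayoff_request i.2 i.1 lam).comp measurable_snd
  have h2 : Measurable fun q : (Fin n → p.Record) × p.Phase =>
      p.probePayoff (σ.φ n (q.1, p.request q.2)) (σ.ψ n (q.1, p.request q.2)) lam
        (p.request q.2) q.2.2 :=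
    measurable_of_countable_fibers (σ.measurableSet_choice n) h1
  exact Measurable.ite (σ.measurableSet_level n {0}) h0
    (Measurable.ite (σ.measurableSet_level n {j | p.IsLevel j}) h2 measurable_const)

end Measurability

variable {n : ℕ} (H : Fin n → p.Record)

lemma phaseVolume_nonneg (v : p.Phase) : 0 ≤ σ.phaseVolume n H v := by
  unfold phaseVolume
  refine add_nonneg ?_ ?_
  · split_ifs
    exacts [mul_nonneg (p.Rd_nonneg _) p.Tc_pos.le, le_rfl]
  · split_ifs with h
    exacts [mul_nonneg (p.Rr_nonneg _ _ _ _) (sub_nonneg.2 h.1.τCE_le), le_rfl]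

lemma phaseVolume_eq_zero {v : p.Phase} (h : ¬ σ.PhaseStops n H v) : σ.phaseVolume n H v = 0 := by
  have h' := not_or.1 h
  unfold phaseVolume
  rw [if_neg h'.1, if_neg h'.2, add_zero]

open Classical in
-- The dominating function depends on neither the strategy nor the history; the uniform stopping
-- probability rests on this.
lemma phaseVolume_le (v : p.Phase) : σ.phaseVolume n H v ≤ p.Tc * p.rateBound v := by
  have hR := p.rateBound_nonneg v
  have hT := p.Tc_pos
  unfold phaseVolume
  by_cases h0 : σ.ψ n (H, p.request v) = 0
  · have h1 : ¬ p.IsLevel (σ.ψ n (H, p.request v)) := by rw [h0]; exact not_isLevel_zero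
    simp only [h0, not_isLevel_zero, if_true, false_and, if_false, add_zero]
    rw [mul_comm]
    exact mul_le_mul_of_nonneg_left (p.Rd_le_rateBound v) hT.le
  · rw [if_neg h0, zero_add]
    split_ifs with h
    · rw [mul_comm]
      exact mul_le_mul (by linarith [p.τCE_pos (σ.ψ n (H, p.request v))]) (p.Rr_le _ _ _ _)
        (p.Rr_nonneg _ _ _ _) hT.le
    · positivity

lemma τRA_le_phaseTime (v : p.Phase) : p.τRA ≤ σ.phaseTime n H v := by
  unfold phaseTime
  split_ifs
  · linarith [p.Tc_pos]
  · linarith [p.τCE_pos (σ.ψ n (H, p.request v))]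
  · linarith

lemma phaseTime_le (v : p.Phase) : σ.phaseTime n H v ≤ p.τRA + p.Tc := by
  unfold phaseTime
  split_ifs with h1 h2
  · exact le_rfl
  · linarith [h2.τCE_le]
  · linarith [p.Tc_pos]

lemma integrable_phaseVolume : Integrable (σ.phaseVolume n H) p.phaseLaw := by
  refine (p.integrable_rateBound.const_mul p.Tc).mono'
    ((σ.measurable_phaseVolume n).comp measurable_prodMk_left).aestronglyMeasurable
    (Filter.Eventually.of_forall fun v => ?_)
  rw [Real.norm_of_nonneg (σ.phaseVolume_nonneg H v)]
  exact σ.phaseVolume_le H v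

lemma integrable_phaseTime : Integrable (σ.phaseTime n H) p.phaseLaw := by
  refine (integrable_const (p.τRA + p.Tc)).mono'
    ((σ.measurable_phaseTime n).comp measurable_prodMk_left).aestronglyMeasurable
    (Filter.Eventually.of_forall fun v => ?_)
  rw [Real.norm_of_nonneg (p.τRA_pos.le.trans (σ.τRA_le_phaseTime H v))]
  exact σ.phaseTime_le H v

lemma integrable_choiceValue (lam : ℝ) : Integrable (σ.choiceValue lam n H) p.phaseLaw := by
  refine Integrable.mono' ((p.integrable_rateBound.const_mul p.Tc).add
    (integrable_const (|lam| * p.Tc)))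
    ((σ.measurable_choiceValue n lam).comp measurable_prodMk_left).aestronglyMeasurable
    (Filter.Eventually.of_forall fun v => ?_)
  have hR := p.rateBound_nonneg v
  have hT := p.Tc_pos
  simp only [choiceValue, Pi.add_apply]
  split_ifs with h0 h1
  · rw [sub_mul]
    refine (abs_sub _ _).trans (add_le_add ?_ ?_)
    · rw [abs_of_nonneg (mul_nonneg (p.Rd_nonneg _) hT.le), mul_comm]
      exact mul_le_mul_of_nonneg_left (p.Rd_le_rateBound v) hT.le
    · rw [abs_mul, abs_of_pos hT]
  · exact abs_probePayoff_le h1 _ lam (p.request v) v.2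
  · rw [norm_zero]; positivity

-- A stopping phase is charged `Tc` beyond `τRA`, with the probing time included in `Tc`. After
-- probing, the net profit is therefore one of the two branches of the maximum in `probePayoff`.
open Classical in
lemma net_le_choiceValue (lam : ℝ) (v : p.Phase) :
    σ.phaseVolume n H v - lam * (σ.phaseTime n H v - p.τRA) ≤ σ.choiceValue lam n H v := by
  unfold phaseVolume phaseTime choiceValue PhaseStops
  by_cases h0 : σ.ψ n (H, p.request v) = 0
  · simp only [h0, not_isLevel_zero, if_true, false_and, if_false, true_or]
    linarith
  · by_cases h1 : p.IsLevel (σ.ψ n (H, p.request v))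
    · by_cases h2 : σ.η n (H, σ.record n H v) = 0
      · simp only [h0, h1, h2, if_true, if_false, true_and, or_true]
        refine le_trans (le_of_eq ?_) (le_max_left _ _)
        ring
      · simp only [h0, h1, h2, if_true, if_false, true_and, or_false]
        refine le_trans (le_of_eq ?_) (le_max_right _ _)
        ring
    · simp [h0, h1]

lemma record_of_isLevel {v : p.Phase} (h : p.IsLevel (σ.ψ n (H, p.request v))) :
    σ.record n H v = (p.request v,
      p.probeObs (σ.ψ n (H, p.request v)) (σ.φ n (H, p.request v)) v.2) := by
  unfold record
  rw [if_pos h]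

open Classical in
lemma FollowsRule.net_eq_choiceValue {σ : p.Strategy} {lam : ℝ} (hσ : σ.FollowsRule lam)
    (H : Fin n → p.Record) (v : p.Phase) :
    σ.phaseVolume n H v - lam * (σ.phaseTime n H v - p.τRA) = σ.choiceValue lam n H v := by
  unfold phaseVolume phaseTime choiceValue PhaseStops
  by_cases hd : p.PrefersDirect lam (p.request v)
  · simp only [hσ.direct n H _ hd, not_isLevel_zero, if_true, false_and, if_false, true_or]
    ring
  by_cases hs : p.PrefersSkip lam (p.request v)
  · have : Fin.last (p.Jbar + 1) ≠ 0 := Fin.last_pos.ne'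
    simp only [hσ.skip n H _ hs, this, not_isLevel_last, if_false, false_and, false_or, sub_self,
      mul_zero, add_zero]
  have h1 := (hσ.probe n H _ hd hs).1
  have h0 := h1.ne_zero
  have h2 := hσ.second n H _ (p.probeObs (σ.ψ n (H, p.request v)) (σ.φ n (H, p.request v)) v.2)
    hd hs
  rw [← σ.record_of_isLevel H h1] at h2
  have hT := h1.τCE_le
  by_cases h3 : σ.η n (H, σ.record n H v) = 0
  · have h4 := h2.1 h3
    simp only [h0, h1, h3, if_true, if_false, true_and, or_true]
    unfold probePayoff
    -- The two branches differ by `(Tc - τCE) * (Rr - lam)`, so the second threshold selects the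
    -- larger one.
    rw [max_eq_left (by nlinarith [mul_nonneg (sub_nonneg.2 hT) (sub_nonneg.2 h4)])]
    ring
  · have h4 := (not_le.1 (mt h2.2 h3)).le
    simp only [h0, h1, h3, if_true, if_false, true_and, or_false]
    unfold probePayoff
    rw [max_eq_right (by nlinarith [mul_nonneg (sub_nonneg.2 hT) (sub_nonneg.2 h4)])]
    ring

open Classical in
/-- The mean payoff of a phase given the request. -/
def meanChoice (lam : ℝ) (n : ℕ) (H : Fin n → p.Record) (x : p.Request) : ℝ :=
  if σ.ψ n (H, x) = 0 then (p.Rd x - lam) * p.Tc else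
    if p.IsLevel (σ.ψ n (H, x)) then p.Θ (σ.φ n (H, x)) (σ.ψ n (H, x)) lam x else 0

lemma meanChoice_le (lam : ℝ) (x : p.Request) : σ.meanChoice lam n H x ≤ p.bestValue lam x := by
  unfold meanChoice bestValue
  split_ifs with h0 h1
  · exact (le_max_left _ _).trans (le_max_left _ _)
  · exact (p.Θ_le_maxΘ (q := (σ.φ n (H, x), (σ.ψ n (H, x) : ℕ)))
      ⟨σ.φ_granted n (H, x), h1⟩).trans (le_max_right _ _)
  · exact (le_max_right _ _).trans (le_max_left _ _)

lemma FollowsRule.meanChoice_eq {σ : p.Strategy} {lam : ℝ} (hσ : σ.FollowsRule lam)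
    (H : Fin n → p.Record) (x : p.Request) : σ.meanChoice lam n H x = p.bestValue lam x := by
  unfold meanChoice
  by_cases hd : p.PrefersDirect lam x
  · rw [if_pos (hσ.direct n H x hd), bestValue_of_prefersDirect hd]
  by_cases hs : p.PrefersSkip lam x
  · rw [hσ.skip n H x hs, if_neg Fin.last_pos.ne', if_neg not_isLevel_last,
      bestValue_of_prefersSkip hs]
  obtain ⟨h1, h2⟩ := hσ.probe n H x hd hs
  rw [if_neg h1.ne_zero, if_pos h1, bestValue_of_probe hd hs]
  refine le_antisymm (p.Θ_le_maxΘ (q := (σ.φ n (H, x), (σ.ψ n (H, x) : ℕ)))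
      ⟨σ.φ_granted n (H, x), h1⟩) ?_
  obtain ⟨q, hq, hqe⟩ := p.exists_Θ_eq_maxΘ lam x
  exact hqe ▸ h2 q hq

-- Level and probing vector are fixed before the RIS gains are revealed, so averaging over these
-- gains turns the payoff of probing into `Θ`.
open Classical in
lemma integral_choiceValue_risLaw (lam : ℝ)
    (u : (Fin p.K → Fin p.S) × (Fin p.K → Fin p.C → ℂ)) :
    ∫ z, σ.choiceValue lam n H (u, z) ∂p.risLaw = σ.meanChoice lam n H (p.request (u, 0)) := by
  have hr : ∀ z, p.request (u, z) = p.request (u, 0) := fun _ => rfl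
  simp only [choiceValue, hr, meanChoice]
  split_ifs
  · simp
  · rfl
  · simp

lemma integral_choiceValue_eq (lam : ℝ) :
    ∫ v, σ.choiceValue lam n H v ∂p.phaseLaw
      = ∫ u, σ.meanChoice lam n H (p.request (u, 0)) ∂p.directLaw := by
  have h := integral_prod (μ := p.directLaw) (ν := p.risLaw)
    (fun v => σ.choiceValue lam n H v) (σ.integrable_choiceValue H lam)
  rw [phaseLaw_eq, h]
  simp only [integral_choiceValue_risLaw]

lemma meanBest_eq (lam : ℝ) :
    Integrable (fun u => p.bestValue lam (p.request (u, 0))) p.directLaw ∧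
      p.meanBest lam = ∫ u, p.bestValue lam (p.request (u, 0)) ∂p.directLaw := by
  have hi := p.integrable_bestValue lam
  have h := integral_prod (μ := p.directLaw) (ν := p.risLaw)
    (fun v => p.bestValue lam (p.request v)) hi
  have hr : ∀ u z, p.request (u, z) = p.request (u, 0) := fun _ _ => rfl
  have h2 := Integrable.integral_prod_left (μ := p.directLaw) (ν := p.risLaw) hi
  simp only [hr, integral_const, probReal_univ, one_smul] at h h2
  exact ⟨h2, h⟩

lemma integral_choiceValue_le (lam : ℝ) :
    ∫ v, σ.choiceValue lam n H v ∂p.phaseLaw ≤ p.meanBest lam := by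
  obtain ⟨h1, h2⟩ := meanBest_eq (p := p) lam
  rw [σ.integral_choiceValue_eq H, h2]
  have h := Integrable.integral_prod_left (μ := p.directLaw) (ν := p.risLaw)
    (σ.integrable_choiceValue H lam)
  simp only [integral_choiceValue_risLaw] at h
  exact integral_mono h h1 fun u => σ.meanChoice_le H lam _

lemma FollowsRule.integral_choiceValue_eq {σ : p.Strategy} {lam : ℝ} (hσ : σ.FollowsRule lam)
    (H : Fin n → p.Record) : ∫ v, σ.choiceValue lam n H v ∂p.phaseLaw = p.meanBest lam := by
  rw [Strategy.integral_choiceValue_eq, (meanBest_eq lam).2]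
  simp only [hσ.meanChoice_eq]

lemma integral_net (lam : ℝ) :
    ∫ v, (σ.phaseVolume n H v - lam * (σ.phaseTime n H v - p.τRA)) ∂p.phaseLaw
      = ∫ v, σ.phaseVolume n H v ∂p.phaseLaw
        - lam * (∫ v, σ.phaseTime n H v ∂p.phaseLaw) + lam * p.τRA := by
  have h := σ.integrable_phaseTime H
  have h' : Integrable (fun v => lam * (σ.phaseTime n H v - p.τRA)) p.phaseLaw :=
    (h.sub (integrable_const _)).const_mul _
  rw [integral_sub (σ.integrable_phaseVolume H) h',
    integral_const_mul, integral_sub h (integrable_const _)]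
  simp
  ring

lemma lintegral_phaseVolume : ∫⁻ v, ENNReal.ofReal (σ.phaseVolume n H v) ∂p.phaseLaw
    = ENNReal.ofReal (∫ v, σ.phaseVolume n H v ∂p.phaseLaw) :=
  (ofReal_integral_eq_lintegral_ofReal (σ.integrable_phaseVolume H)
    (Filter.Eventually.of_forall (σ.phaseVolume_nonneg H))).symm

lemma lintegral_phaseTime : ∫⁻ v, ENNReal.ofReal (σ.phaseTime n H v) ∂p.phaseLaw
    = ENNReal.ofReal (∫ v, σ.phaseTime n H v ∂p.phaseLaw) :=
  (ofReal_integral_eq_lintegral_ofReal (σ.integrable_phaseTime H)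
    (Filter.Eventually.of_forall fun v => p.τRA_pos.le.trans (σ.τRA_le_phaseTime H v))).symm

/-- The mean net profit, without the request charge, is at most `meanBest lam = lam * τRA`; moving
all time costs to the right leaves nonnegative quantities that can be summed over phases. -/
lemma lintegral_phaseVolume_le {lam : ℝ} (h0 : 0 ≤ lam) (hlam : p.meanBest lam = lam * p.τRA) :
    ∫⁻ v, ENNReal.ofReal (σ.phaseVolume n H v) ∂p.phaseLaw
      ≤ ENNReal.ofReal lam * ∫⁻ v, ENNReal.ofReal (σ.phaseTime n H v) ∂p.phaseLaw := by
  rw [lintegral_phaseVolume, lintegral_phaseTime, ← ENNReal.ofReal_mul h0]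
  refine ENNReal.ofReal_le_ofReal ?_
  have h1 := integral_mono ((σ.integrable_phaseVolume H).sub
    (((σ.integrable_phaseTime H).sub (integrable_const p.τRA)).const_mul lam))
    (σ.integrable_choiceValue H lam) fun v => σ.net_le_choiceValue H lam v
  have h2 := σ.integral_choiceValue_le H lam
  have h3 := σ.integral_net H lam
  simp only [Pi.sub_apply] at h1
  linarith

lemma FollowsRule.lintegral_phaseVolume_eq {σ : p.Strategy} {lam : ℝ} (hσ : σ.FollowsRule lam)
    (h0 : 0 ≤ lam) (hlam : p.meanBest lam = lam * p.τRA) (H : Fin n → p.Record) :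
    ∫⁻ v, ENNReal.ofReal (σ.phaseVolume n H v) ∂p.phaseLaw
      = ENNReal.ofReal lam * ∫⁻ v, ENNReal.ofReal (σ.phaseTime n H v) ∂p.phaseLaw := by
  rw [lintegral_phaseVolume, lintegral_phaseTime, ← ENNReal.ofReal_mul h0]
  have h3 := σ.integral_net H lam
  simp only [hσ.net_eq_choiceValue, hσ.integral_choiceValue_eq] at h3
  congr 1
  linarith

/-! ### The probability of transmission after a phase -/

/-- When time is free, nonnegative rates leave no reason to skip in either layer. -/
lemma FollowsRule.phaseStops_of_zero {σ : p.Strategy} (hσ : σ.FollowsRule 0)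
    (H : Fin n → p.Record) (v : p.Phase) : σ.PhaseStops n H v := by
  by_cases hd : p.PrefersDirect 0 (p.request v)
  · exact Or.inl (hσ.direct n H _ hd)
  have hs : ¬ p.PrefersSkip 0 (p.request v) := fun h =>
    absurd ((le_max_left _ _).trans_lt h)
      (not_lt.2 (mul_nonneg (by simpa using p.Rd_nonneg _) p.Tc_pos.le))
  have h1 := (hσ.probe n H _ hd hs).1
  refine Or.inr ⟨h1, ?_⟩
  rw [σ.record_of_isLevel H h1]
  exact (hσ.second n H _ _ hd hs).2 (p.Rr_nonneg _ _ _ _)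

lemma exists_le_measure_phaseStops {lam : ℝ} (h0 : 0 ≤ lam)
    (hlam : p.meanBest lam = lam * p.τRA) :
    ∃ δ : ℝ≥0∞, 0 < δ ∧ ∀ σ : p.Strategy, σ.FollowsRule lam → ∀ n (H : Fin n → p.Record),
      δ ≤ p.phaseLaw {v | σ.PhaseStops n H v} := by
  rcases h0.eq_or_lt with rfl | hpos
  · refine ⟨1, one_pos, fun σ hσ n H => ?_⟩
    simp [hσ.phaseStops_of_zero H]
  have hD : ∫⁻ v, ENNReal.ofReal (p.Tc * p.rateBound v) ∂p.phaseLaw ≠ ⊤ :=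
    (p.integrable_rateBound.const_mul p.Tc).lintegral_lt_top.ne
  have hε : ENNReal.ofReal lam * ENNReal.ofReal p.τRA ≠ 0 :=
    mul_ne_zero (ENNReal.ofReal_pos.2 hpos).ne' (ENNReal.ofReal_pos.2 p.τRA_pos).ne'
  -- Absolute continuity of the integral: on an event of probability below `δ` the dominating
  -- function could not carry the mean volume `lam * τRA` that breaking even demands.
  obtain ⟨δ, hδ, h⟩ := exists_pos_setLIntegral_lt_of_measure_lt hD hε
  refine ⟨δ, hδ, fun σ hσ n H => not_lt.1 fun hlt => ?_⟩
  refine absurd (h _ hlt) (not_lt.2 ?_)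
  have hS : MeasurableSet {v | σ.PhaseStops n H v} :=
    measurable_prodMk_left (σ.measurableSet_phaseStops n)
  calc ENNReal.ofReal lam * ENNReal.ofReal p.τRA
      = ENNReal.ofReal lam * ∫⁻ _v, ENNReal.ofReal p.τRA ∂p.phaseLaw := by simp
    _ ≤ ENNReal.ofReal lam * ∫⁻ v, ENNReal.ofReal (σ.phaseTime n H v) ∂p.phaseLaw := by
      gcongr with v
      exact σ.τRA_le_phaseTime H v
    _ = ∫⁻ v, ENNReal.ofReal (σ.phaseVolume n H v) ∂p.phaseLaw :=
      (hσ.lintegral_phaseVolume_eq h0 hlam H).symm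
    _ ≤ ∫⁻ v, {v | σ.PhaseStops n H v}.indicator
        (fun v => ENNReal.ofReal (p.Tc * p.rateBound v)) v ∂p.phaseLaw := by
      refine lintegral_mono fun v => ?_
      by_cases hv : σ.PhaseStops n H v
      · rw [Set.indicator_of_mem (by exact hv)]
        exact ENNReal.ofReal_le_ofReal (σ.phaseVolume_le H v)
      · simp [σ.phaseVolume_eq_zero H hv]
    _ = _ := lintegral_indicator hS _

end Strategy

end Network

end RISAccess

end

/-! ### From single phases to the whole frame: decomposition, independence, optimality. -/

noncomputable section

namespace RISAccess

namespace Network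

variable {p : Network}

namespace Strategy

variable (σ : p.Strategy)

/-! ### The frame as a sequence of phases -/

/-- No data are transmitted in the first `n` phases. -/
def Alive (w : ℕ → p.Phase) (n : ℕ) : Prop := ∀ m < n, ¬ σ.Stops w m

variable {σ} in
lemma alive_zero (w : ℕ → p.Phase) : σ.Alive w 0 := fun _ h => absurd h (Nat.not_lt_zero _)

variable {σ} in
lemma alive_succ {w : ℕ → p.Phase} {n : ℕ} :
    σ.Alive w (n + 1) ↔ σ.Alive w n ∧ ¬ σ.PhaseStops n (σ.history w n) (w n) :=
  ⟨fun h => ⟨fun m hm => h m (hm.trans n.lt_succ_self), h n n.lt_succ_self⟩,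
    fun h m hm => (Nat.lt_succ_iff_lt_or_eq.1 hm).elim (h.1 m) fun e => e ▸ h.2⟩

-- Phases that do not stop have volume zero, and no phase after the stopping one is alive, so at
-- most one term is nonzero.
open Classical in
lemma frameVolume_eq_tsum (w : ℕ → p.Phase) :
    σ.frameVolume w = ∑' n, if σ.Alive w n then
      ENNReal.ofReal (σ.phaseVolume n (σ.history w n) (w n)) else 0 := by
  unfold frameVolume
  split_ifs with h
  · rw [tsum_eq_single (Nat.find h) fun n hn => ?_,
      if_pos (show σ.Alive w _ from fun m hm => Nat.find_min h hm)]
    · rfl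
    · split_ifs with ha
      · have hs : ¬ σ.PhaseStops n (σ.history w n) (w n) := fun hs =>
          (Nat.find_min' h hs).lt_or_eq.elim (fun hlt => ha _ hlt (Nat.find_spec h))
            fun e => hn e.symm
        rw [σ.phaseVolume_eq_zero _ hs, ENNReal.ofReal_zero]
      · rfl
  · refine (ENNReal.tsum_eq_zero.2 fun n => ?_).symm
    have hs : ¬ σ.PhaseStops n (σ.history w n) (w n) := fun hs => h ⟨n, hs⟩
    rw [σ.phaseVolume_eq_zero _ hs, ENNReal.ofReal_zero, ite_self]

-- In a frame that never ends every term is at least `τRA`, so the series diverges, in agreement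
-- with the value `⊤`.
open Classical in
lemma frameDuration_eq_tsum (w : ℕ → p.Phase) :
    σ.frameDuration w = ∑' n, if σ.Alive w n then
      ENNReal.ofReal (σ.phaseTime n (σ.history w n) (w n)) else 0 := by
  unfold frameDuration
  split_ifs with h
  · have hN : σ.PhaseStops (Nat.find h) (σ.history w (Nat.find h)) (w (Nat.find h)) :=
      Nat.find_spec h
    have hlt : ∀ m < Nat.find h, ¬ σ.PhaseStops m (σ.history w m) (w m) := fun m hm =>
      Nat.find_min h hm
    have halive : ∀ n ∈ Finset.range (Nat.find h + 1), σ.Alive w n := fun n hn m hm =>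
      hlt m (hm.trans_le (Nat.lt_succ_iff.1 (Finset.mem_range.1 hn)))
    rw [tsum_eq_sum (s := Finset.range (Nat.find h + 1)) fun n hn => if_neg fun ha =>
        ha _ (by simpa using hn) hN,
      Finset.sum_congr rfl fun n hn => if_pos (halive n hn),
      ← ENNReal.ofReal_sum_of_nonneg fun n _ => p.τRA_pos.le.trans (σ.τRA_le_phaseTime _ _)]
    congr 1
    rw [Finset.sum_range_succ]
    have h1 : ∀ m ∈ Finset.range (Nat.find h), σ.phaseTime m (σ.history w m) (w m)
        = p.τRA + if p.IsLevel (σ.psiAt w m) then p.τCE (σ.psiAt w m) else 0 := fun m hm => by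
      unfold phaseTime
      rw [if_neg (hlt m (Finset.mem_range.1 hm))]
      rfl
    rw [Finset.sum_congr rfl h1, Finset.sum_add_distrib]
    unfold phaseTime durationAt
    rw [if_pos hN]
    simp
    ring
  · refine (top_le_iff.1 ?_).symm
    rw [← ENNReal.tsum_const_eq_top_of_ne_zero (α := ℕ) (ENNReal.ofReal_pos.2 p.τRA_pos).ne']
    refine ENNReal.tsum_le_tsum fun n => ?_
    rw [if_pos (show σ.Alive w n from fun m _ hm => h ⟨m, hm⟩)]
    exact ENNReal.ofReal_le_ofReal (σ.τRA_le_phaseTime _ _)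

/-! ### The past of a phase -/

lemma measurable_history (n : ℕ) : Measurable fun w : ℕ → p.Phase => σ.history w n := by
  induction n with
  | zero => exact measurable_pi_iff.2 fun i => i.elim0
  | succ n ih =>
    refine measurable_pi_iff.2 fun i => ?_
    refine Fin.lastCases ?_ (fun i => ?_) i
    · simp only [history, Fin.snoc_last]
      exact (σ.measurable_record n).comp (ih.prodMk (measurable_pi_apply n))
    · simp only [history, Fin.snoc_castSucc]
      exact (measurable_pi_apply i).comp ih

lemma measurableSet_stops (n : ℕ) : MeasurableSet {w : ℕ → p.Phase | σ.Stops w n} :=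
  ((σ.measurable_history n).prodMk (measurable_pi_apply n)) (σ.measurableSet_phaseStops n)

lemma measurableSet_alive (n : ℕ) : MeasurableSet {w : ℕ → p.Phase | σ.Alive w n} := by
  have : {w : ℕ → p.Phase | σ.Alive w n} = ⋂ m ∈ Set.Iio n, {w | σ.Stops w m}ᶜ := by
    ext w; simp [Alive]
  rw [this]
  exact MeasurableSet.biInter (Set.to_countable _) fun m _ => (σ.measurableSet_stops m).compl

-- Decisions are nonanticipating. This is what allows the future to be replaced by a constant in
-- `truncate`, and thereby makes the past independent of the present phase.
variable {σ} in
lemma history_congr {w w' : ℕ → p.Phase} {n : ℕ} (h : ∀ m < n, w m = w' m) :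
    σ.history w n = σ.history w' n := by
  induction n with
  | zero => rfl
  | succ n ih =>
    unfold history
    rw [ih fun m hm => h m (hm.trans n.lt_succ_self), h n n.lt_succ_self]

variable {σ} in
lemma alive_congr {w w' : ℕ → p.Phase} {n : ℕ} (h : ∀ m < n, w m = w' m) :
    σ.Alive w n ↔ σ.Alive w' n := by
  refine forall₂_congr fun m hm => not_congr ?_
  change σ.PhaseStops m _ _ ↔ σ.PhaseStops m _ _
  rw [history_congr fun l hl => h l (hl.trans hm), h m hm]

end Strategy

/-- A sequence of phases with all phases from number `n` on replaced by a fixed one. -/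
def truncate (v : p.Phase) (n : ℕ) (t : Finset.range n → p.Phase) (m : ℕ) : p.Phase :=
  if h : m < n then t ⟨m, Finset.mem_range.2 h⟩ else v

lemma measurable_truncate (v : p.Phase) (n : ℕ) : Measurable (truncate v n) := by
  refine measurable_pi_iff.2 fun m => ?_
  by_cases h : m < n
  · simp only [truncate, h, dif_pos]
    exact measurable_pi_apply _
  · simp only [truncate, h, dif_neg, not_false_eq_true]
    exact measurable_const

lemma ofReal_τRA_le_frameDuration (σ : p.Strategy) (w : ℕ → p.Phase) :
    ENNReal.ofReal p.τRA ≤ σ.frameDuration w := by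
  classical
  rw [σ.frameDuration_eq_tsum]
  refine le_trans ?_ (ENNReal.le_tsum 0)
  rw [if_pos (Strategy.alive_zero w)]
  exact ENNReal.ofReal_le_ofReal (σ.τRA_le_phaseTime _ _)

lemma measurable_frameDuration (σ : p.Strategy) : Measurable σ.frameDuration := by
  classical
  have : σ.frameDuration = fun w => ∑' n, {w | σ.Alive w n}.indicator
      (fun w => ENNReal.ofReal (σ.phaseTime n (σ.history w n) (w n))) w := by
    funext w
    simp only [σ.frameDuration_eq_tsum, Set.indicator_apply, Set.mem_ofPred_eq]
  rw [this]
  refine Measurable.tsum fun n => Measurable.indicator ?_ (σ.measurableSet_alive n)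
  exact ((σ.measurable_phaseTime n).comp
    ((σ.measurable_history n).prodMk (measurable_pi_apply n))).ennreal_ofReal

/-- A frame that never ends has infinite duration, which a finite mean permits only on a null set.
-/
lemma ae_exists_stops {Ω : Type*} [MeasurableSpace Ω] {P : Measure Ω} {X : ℕ → Ω → p.Phase}
    (hX : ∀ n, Measurable (X n)) (σ : p.Strategy) (h : meanDuration P X σ ≠ ⊤) :
    ∀ᵐ ω ∂P, ∃ n, σ.Stops (fun n => X n ω) n := by
  have hm : Measurable fun ω => σ.frameDuration fun n => X n ω :=
    (measurable_frameDuration σ).comp (measurable_pi_iff.2 hX)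
  filter_upwards [ae_lt_top hm h] with ω hω
  by_contra hn
  rw [Strategy.frameDuration, dif_neg hn] at hω
  exact lt_irrefl _ hω

section Independence

variable {Ω : Type*} [MeasurableSpace Ω] {P : Measure Ω} [IsProbabilityMeasure P]
  {X : ℕ → Ω → p.Phase}

/-- Being alive and the history are functions of the phases before `n`, so phase `n` is a fresh draw
and may be averaged first, with the past held fixed. -/
lemma lintegral_past_present (hX : ∀ n, Measurable (X n)) (hlaw : ∀ n, P.map (X n) = p.phaseLaw)
    (hind : iIndepFun X P) (σ : p.Strategy) (n : ℕ) {F : (Fin n → p.Record) × p.Phase → ℝ≥0∞}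
    (hF : Measurable F) :
    ∫⁻ ω, {w | σ.Alive w n}.indicator (fun w => F (σ.history w n, w n)) (fun n => X n ω) ∂P
      = ∫⁻ ω, {w | σ.Alive w n}.indicator
          (fun w => ∫⁻ v, F (σ.history w n, v) ∂p.phaseLaw) (fun n => X n ω) ∂P := by
  classical
  obtain ⟨ω₀⟩ : Nonempty Ω := P.nonempty_of_neZero
  -- The filler `X 0 ω₀` is an arbitrary constant; the padded sequence depends on finitely many
  -- phases yet still has the type that `history` and `Alive` take.
  let past : Ω → ℕ → p.Phase := fun ω => truncate (X 0 ω₀) n fun m => X m ω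
  have hpast : Measurable past :=
    (measurable_truncate _ n).comp (measurable_pi_iff.2 fun m => hX m)
  have hagree : ∀ ω, ∀ m < n, X m ω = past ω m := fun ω m hm => by simp [past, truncate, hm]
  have hindep : IndepFun past (X n) P := by
    have h := hind.indepFun_finset (Finset.range n) {n} (by simp) hX
    exact h.comp (measurable_truncate (X 0 ω₀) n)
      (measurable_pi_apply (⟨n, Finset.mem_singleton_self n⟩ : ({n} : Finset ℕ)))
  have hmap := (indepFun_iff_map_prod_eq_prod_map_map hpast.aemeasurable
    (hX n).aemeasurable).1 hindep
  rw [hlaw n] at hmap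
  have hA := σ.measurableSet_alive n
  let G : (ℕ → p.Phase) × p.Phase → ℝ≥0∞ :=
    {q : (ℕ → p.Phase) × p.Phase | σ.Alive q.1 n}.indicator fun q => F (σ.history q.1 n, q.2)
  have hG : Measurable G :=
    (hF.comp (((σ.measurable_history n).comp measurable_fst).prodMk measurable_snd)).indicator
      (measurable_fst hA)
  have h1 : ∀ ω, {w | σ.Alive w n}.indicator (fun w => F (σ.history w n, w n)) (fun n => X n ω)
      = G (past ω, X n ω) := fun ω => by
    simp only [G, Set.indicator_apply, Set.mem_ofPred_eq,
      Strategy.alive_congr (σ := σ) (hagree ω), Strategy.history_congr (σ := σ) (hagree ω)]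
  have h2 : ∀ ω, {w | σ.Alive w n}.indicator
      (fun w => ∫⁻ v, F (σ.history w n, v) ∂p.phaseLaw) (fun n => X n ω)
      = ∫⁻ v, G (past ω, v) ∂p.phaseLaw := fun ω => by
    simp only [G, Set.indicator_apply, Set.mem_ofPred_eq,
      Strategy.alive_congr (σ := σ) (hagree ω), Strategy.history_congr (σ := σ) (hagree ω)]
    split_ifs <;> simp
  simp only [h1, h2]
  rw [← lintegral_map hG (hpast.prodMk (hX n)), hmap, lintegral_prod _ hG.aemeasurable,
    lintegral_map hG.lintegral_prod_right' hpast]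

lemma lintegral_frame_eq_tsum (hX : ∀ n, Measurable (X n))
    (hlaw : ∀ n, P.map (X n) = p.phaseLaw) (hind : iIndepFun X P) (σ : p.Strategy)
    {F : ∀ n, (Fin n → p.Record) × p.Phase → ℝ≥0∞} (hF : ∀ n, Measurable (F n)) :
    ∫⁻ ω, ∑' n, {w | σ.Alive w n}.indicator (fun w => F n (σ.history w n, w n))
        (fun n => X n ω) ∂P
      = ∑' n, ∫⁻ ω, {w | σ.Alive w n}.indicator
          (fun w => ∫⁻ v, F n (σ.history w n, v) ∂p.phaseLaw) (fun n => X n ω) ∂P := by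
  have hXm : Measurable fun ω n => X n ω := measurable_pi_iff.2 hX
  rw [lintegral_tsum fun n => ?_]
  · exact tsum_congr fun n => lintegral_past_present hX hlaw hind σ n (hF n)
  · exact ((((hF n).comp ((σ.measurable_history n).prodMk (measurable_pi_apply n))).indicator
      (σ.measurableSet_alive n)).comp hXm).aemeasurable

lemma meanVolume_eq (hX : ∀ n, Measurable (X n)) (hlaw : ∀ n, P.map (X n) = p.phaseLaw)
    (hind : iIndepFun X P) (σ : p.Strategy) :
    meanVolume P X σ = ∑' n, ∫⁻ ω, {w | σ.Alive w n}.indicator (fun w =>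
      ∫⁻ v, ENNReal.ofReal (σ.phaseVolume n (σ.history w n) v) ∂p.phaseLaw)
        (fun n => X n ω) ∂P := by
  classical
  rw [← lintegral_frame_eq_tsum hX hlaw hind σ
    (F := fun n q => ENNReal.ofReal (σ.phaseVolume n q.1 q.2))
    fun n => (σ.measurable_phaseVolume n).ennreal_ofReal]
  simp only [meanVolume, Strategy.frameVolume_eq_tsum, Set.indicator_apply, Set.mem_ofPred_eq]

lemma meanDuration_eq (hX : ∀ n, Measurable (X n)) (hlaw : ∀ n, P.map (X n) = p.phaseLaw)
    (hind : iIndepFun X P) (σ : p.Strategy) :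
    meanDuration P X σ = ∑' n, ∫⁻ ω, {w | σ.Alive w n}.indicator (fun w =>
      ∫⁻ v, ENNReal.ofReal (σ.phaseTime n (σ.history w n) v) ∂p.phaseLaw)
        (fun n => X n ω) ∂P := by
  classical
  rw [← lintegral_frame_eq_tsum hX hlaw hind σ
    (F := fun n q => ENNReal.ofReal (σ.phaseTime n q.1 q.2))
    fun n => (σ.measurable_phaseTime n).ennreal_ofReal]
  simp only [meanDuration, Strategy.frameDuration_eq_tsum, Set.indicator_apply, Set.mem_ofPred_eq]

lemma ofReal_mul_meanDuration (hX : ∀ n, Measurable (X n))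
    (hlaw : ∀ n, P.map (X n) = p.phaseLaw) (hind : iIndepFun X P) (σ : p.Strategy) (lam : ℝ) :
    ENNReal.ofReal lam * meanDuration P X σ
      = ∑' n, ∫⁻ ω, {w | σ.Alive w n}.indicator (fun w => ENNReal.ofReal lam *
          ∫⁻ v, ENNReal.ofReal (σ.phaseTime n (σ.history w n) v) ∂p.phaseLaw)
            (fun n => X n ω) ∂P := by
  classical
  rw [meanDuration_eq hX hlaw hind, ← ENNReal.tsum_mul_left]
  refine tsum_congr fun n => ?_
  rw [← lintegral_const_mul' _ _ ENNReal.ofReal_ne_top]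
  refine lintegral_congr fun ω => ?_
  simp only [Set.indicator_apply, mul_ite, mul_zero]

/-- If `lam` solves the fixed point equation, then at price `lam` per unit of time no strategy makes
a profit. -/
lemma meanVolume_le (hX : ∀ n, Measurable (X n)) (hlaw : ∀ n, P.map (X n) = p.phaseLaw)
    (hind : iIndepFun X P) (σ : p.Strategy) {lam : ℝ} (h0 : 0 ≤ lam)
    (hlam : p.meanBest lam = lam * p.τRA) :
    meanVolume P X σ ≤ ENNReal.ofReal lam * meanDuration P X σ := by
  rw [meanVolume_eq hX hlaw hind, ofReal_mul_meanDuration hX hlaw hind]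
  exact ENNReal.tsum_le_tsum fun n => lintegral_mono fun ω =>
    Set.indicator_le_indicator (σ.lintegral_phaseVolume_le _ h0 hlam)

/-- If `lam` solves the fixed point equation, then the threshold strategies break even. -/
lemma Strategy.FollowsRule.meanVolume_eq (hX : ∀ n, Measurable (X n))
    (hlaw : ∀ n, P.map (X n) = p.phaseLaw) (hind : iIndepFun X P) {σ : p.Strategy} {lam : ℝ}
    (hσ : σ.FollowsRule lam) (h0 : 0 ≤ lam) (hlam : p.meanBest lam = lam * p.τRA) :
    meanVolume P X σ = ENNReal.ofReal lam * meanDuration P X σ := by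
  rw [Network.meanVolume_eq hX hlaw hind, ofReal_mul_meanDuration hX hlaw hind]
  simp only [hσ.lintegral_phaseVolume_eq h0 hlam]

/-- The expected number of phases is finite if there is a uniform lower bound for the conditional
probability of transmission. -/
lemma tsum_measure_alive_ne_top (hX : ∀ n, Measurable (X n))
    (hlaw : ∀ n, P.map (X n) = p.phaseLaw) (hind : iIndepFun X P) (σ : p.Strategy) {δ : ℝ≥0∞}
    (hδ : 0 < δ) (h : ∀ n (H : Fin n → p.Record), δ ≤ p.phaseLaw {v | σ.PhaseStops n H v}) :
    ∑' n, P {ω | σ.Alive (fun n => X n ω) n} ≠ ⊤ := by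
  classical
  have hXm : Measurable fun ω n => X n ω := measurable_pi_iff.2 hX
  have hA : ∀ n, MeasurableSet {ω | σ.Alive (fun n => X n ω) n} := fun n =>
    hXm (σ.measurableSet_alive n)
  -- Of the frames still alive, at least the fraction `δ` stops in phase `n`. Writing this as a sum
  -- avoids truncated subtraction, and telescoping then bounds `δ` times the sum of the survival
  -- probabilities by 1.
  have step : ∀ n, P {ω | σ.Alive (fun n => X n ω) (n + 1)}
      + δ * P {ω | σ.Alive (fun n => X n ω) n} ≤ P {ω | σ.Alive (fun n => X n ω) n} := by
    intro n
    let S : Set ((Fin n → p.Record) × p.Phase) := {q | σ.PhaseStops n q.1 q.2}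
    have hS : MeasurableSet S := σ.measurableSet_phaseStops n
    have key := lintegral_past_present hX hlaw hind σ n
      (F := S.indicator 1) (measurable_one.indicator hS)
    have h1 : δ * P {ω | σ.Alive (fun n => X n ω) n}
        ≤ ∫⁻ ω, {w | σ.Alive w n}.indicator
          (fun w => ∫⁻ v, S.indicator 1 (σ.history w n, v) ∂p.phaseLaw) (fun n => X n ω) ∂P := by
      rw [← lintegral_indicator_const (hA n)]
      refine lintegral_mono fun ω => ?_
      simp only [Set.indicator_apply, Set.mem_ofPred_eq]
      split_ifs
      · refine (h n (σ.history (fun n => X n ω) n)).trans (le_of_eq ?_)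
        have hs : MeasurableSet {v | σ.PhaseStops n (σ.history (fun n => X n ω) n) v} :=
          measurable_prodMk_left hS
        rw [← lintegral_indicator_one hs]
        simp only [Set.indicator_apply, S, Set.mem_ofPred_eq, Pi.one_apply]
      · exact le_rfl
    have h2 : ∫⁻ ω, {w | σ.Alive w n}.indicator
          (fun w => S.indicator 1 (σ.history w n, w n)) (fun n => X n ω) ∂P
        = P ({ω | σ.Alive (fun n => X n ω) n} \ {ω | σ.Alive (fun n => X n ω) (n + 1)}) := by
      rw [← lintegral_indicator_one ((hA n).diff (hA (n + 1)))]
      refine lintegral_congr fun ω => ?_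
      simp only [Set.indicator_apply, S, Set.mem_ofPred_eq, Set.mem_sdiff, Strategy.alive_succ]
      by_cases ha : σ.Alive (fun n => X n ω) n <;>
        by_cases hs : σ.PhaseStops n (σ.history (fun n => X n ω) n) (X n ω) <;> simp [ha, hs]
    have hsub : {ω | σ.Alive (fun n => X n ω) (n + 1)} ⊆ {ω | σ.Alive (fun n => X n ω) n} :=
      fun ω hω => (Strategy.alive_succ.1 hω).1
    calc _ ≤ P {ω | σ.Alive (fun n => X n ω) (n + 1)}
          + P ({ω | σ.Alive (fun n => X n ω) n} \ {ω | σ.Alive (fun n => X n ω) (n + 1)}) := by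
          rw [← h2, key]
          exact add_le_add_right h1 _
      _ = P {ω | σ.Alive (fun n => X n ω) n} := by
          rw [← measure_inter_add_sdiff {ω | σ.Alive (fun n => X n ω) n} (hA (n + 1)),
            Set.inter_eq_self_of_subset_right hsub]
  have hsum : ∀ N, P {ω | σ.Alive (fun n => X n ω) N}
      + ∑ n ∈ Finset.range N, δ * P {ω | σ.Alive (fun n => X n ω) n} ≤ 1 := by
    intro N
    induction N with
    | zero => simpa using prob_le_one
    | succ N ih =>
      rw [Finset.sum_range_succ, add_comm (∑ n ∈ Finset.range N, _), ← add_assoc]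
      exact (add_le_add_left (step N) _).trans ih
  have hle : δ * ∑' n, P {ω | σ.Alive (fun n => X n ω) n} ≤ 1 := by
    rw [← ENNReal.tsum_mul_left, ENNReal.tsum_eq_iSup_nat]
    exact iSup_le fun N => le_add_self.trans (hsum N)
  intro htop
  rw [htop, ENNReal.mul_top hδ.ne'] at hle
  exact absurd hle (by simp)

/-- Each phase reached costs at most `τRA + Tc`, and the expected number of phases reached is
finite. -/
lemma Strategy.FollowsRule.meanDuration_ne_top (hX : ∀ n, Measurable (X n))
    (hlaw : ∀ n, P.map (X n) = p.phaseLaw) (hind : iIndepFun X P) {σ : p.Strategy} {lam : ℝ}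
    (hσ : σ.FollowsRule lam) (h0 : 0 ≤ lam) (hlam : p.meanBest lam = lam * p.τRA) :
    meanDuration P X σ ≠ ⊤ := by
  classical
  have hXm : Measurable fun ω n => X n ω := measurable_pi_iff.2 hX
  obtain ⟨δ, hδ, h⟩ := exists_le_measure_phaseStops h0 hlam
  have hsum := tsum_measure_alive_ne_top hX hlaw hind σ hδ (h σ hσ)
  refine ne_top_of_le_ne_top
    (ENNReal.mul_ne_top (ENNReal.ofReal_ne_top (r := p.τRA + p.Tc)) hsum) ?_
  rw [meanDuration_eq hX hlaw hind, ← ENNReal.tsum_mul_left]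
  refine ENNReal.tsum_le_tsum fun n => ?_
  have hA : MeasurableSet {ω | σ.Alive (fun n => X n ω) n} := hXm (σ.measurableSet_alive n)
  rw [← lintegral_indicator_const hA]
  refine lintegral_mono fun ω => ?_
  simp only [Set.indicator_apply, Set.mem_ofPred_eq]
  split_ifs
  · calc _ ≤ ∫⁻ _v, ENNReal.ofReal (p.τRA + p.Tc) ∂p.phaseLaw :=
        lintegral_mono fun v => ENNReal.ofReal_le_ofReal (σ.phaseTime_le _ v)
      _ = _ := by simp
  · exact le_rfl

lemma throughput_le (hX : ∀ n, Measurable (X n)) (hlaw : ∀ n, P.map (X n) = p.phaseLaw)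
    (hind : iIndepFun X P) (σ : p.Strategy) {lam : ℝ} (h0 : 0 ≤ lam)
    (hlam : p.meanBest lam = lam * p.τRA) : throughput P X σ ≤ ENNReal.ofReal lam :=
  ENNReal.div_le_of_le_mul (meanVolume_le hX hlaw hind σ h0 hlam)

lemma Strategy.FollowsRule.throughput_eq (hX : ∀ n, Measurable (X n))
    (hlaw : ∀ n, P.map (X n) = p.phaseLaw) (hind : iIndepFun X P) {σ : p.Strategy} {lam : ℝ}
    (hσ : σ.FollowsRule lam) (h0 : 0 ≤ lam) (hlam : p.meanBest lam = lam * p.τRA) :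
    throughput P X σ = ENNReal.ofReal lam := by
  -- Cancelling the duration in `ℝ≥0∞` requires it to be neither zero nor infinite.
  have hpos : meanDuration P X σ ≠ 0 := by
    have h : ENNReal.ofReal p.τRA ≤ meanDuration P X σ := by
      calc ENNReal.ofReal p.τRA = ∫⁻ _ω, ENNReal.ofReal p.τRA ∂P := by simp
        _ ≤ _ := lintegral_mono fun ω => ofReal_τRA_le_frameDuration σ _
    exact ((ENNReal.ofReal_pos.2 p.τRA_pos).trans_le h).ne'
  unfold throughput
  rw [hσ.meanVolume_eq hX hlaw hind h0 hlam]
  exact ENNReal.mul_div_cancel_right hpos (hσ.meanDuration_ne_top hX hlaw hind h0 hlam)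

lemma maxThroughput_eq (hX : ∀ n, Measurable (X n)) (hlaw : ∀ n, P.map (X n) = p.phaseLaw)
    (hind : iIndepFun X P) {lam : ℝ} (h0 : 0 ≤ lam) (hlam : p.meanBest lam = lam * p.τRA) :
    maxThroughput P X = ENNReal.ofReal lam := by
  refine le_antisymm (iSup₂_le fun σ _ => throughput_le hX hlaw hind σ h0 hlam) ?_
  obtain ⟨σ, hσ⟩ := p.exists_followsRule lam
  rw [← hσ.throughput_eq hX hlaw hind h0 hlam]
  exact le_iSup₂_of_le σ (Or.inr (hσ.meanDuration_ne_top hX hlaw hind h0 hlam)) le_rfl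

end Independence

end Network

end RISAccess

end

theorem theorem1 (p : RISAccess.Network) {Ω : Type*} [MeasurableSpace Ω]
    (P : MeasureTheory.Measure Ω) [MeasureTheory.IsProbabilityMeasure P]
    -- the phases are independent and identically distributed
    (X : ℕ → Ω → p.Phase) (hX : ∀ n, Measurable (X n))
    (hlaw : ∀ n, P.map (X n) = p.phaseLaw) (hind : ProbabilityTheory.iIndepFun X P)
    -- the maximal throughput, as a real number
    (lamStar : ℝ)
    (hlamStar : lamStar = (RISAccess.Network.maxThroughput P X).toReal) :
    -- the maximal throughput is finite
    RISAccess.Network.maxThroughput P X ≠ ⊤ ∧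
    -- the threshold function is the conditional expectation of the payoff, given the request
    (∀ (b : p.Alloc) (J : ℕ) (lam : ℝ), p.IsLevel J →
      (∀ x, MeasureTheory.Integrable (p.probePayoff b J lam x) p.risLaw) ∧
      ∀ n,
        MeasureTheory.Integrable
          (fun ω => p.probePayoff b J lam (p.request (X n ω)) (X n ω).2) P ∧
        P[fun ω => p.probePayoff b J lam (p.request (X n ω)) (X n ω).2 |
            MeasurableSpace.comap (fun ω => p.request (X n ω)) inferInstance]
          =ᵐ[P] fun ω => p.Θ b J lam (p.request (X n ω))) ∧
    -- the threshold rule defines strategies, and each of them is optimal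
    (∃ σ : p.Strategy, σ.FollowsRule lamStar) ∧
    (∀ σ : p.Strategy, σ.FollowsRule lamStar →
      (∀ᵐ ω ∂P, ∃ n, σ.Stops (fun n => X n ω) n) ∧
      RISAccess.Network.meanDuration P X σ ≠ ⊤ ∧
      RISAccess.Network.meanVolume P X σ ≠ ⊤ ∧
      RISAccess.Network.throughput P X σ = RISAccess.Network.maxThroughput P X) ∧
    -- the maximal throughput is the unique root of the fixed point equation
    (∀ n (lam : ℝ), MeasureTheory.Integrable (fun ω => p.bestValue lam (p.request (X n ω))) P ∧
      (∫ ω, p.bestValue lam (p.request (X n ω)) ∂P = lam * p.τRA ↔ lam = lamStar)) := by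

  obtain ⟨lam₀, h0, hlam⟩ := p.exists_meanBest_eq
  have hmax := RISAccess.Network.maxThroughput_eq hX hlaw hind h0 hlam
  -- Nonnegativity of the root is what makes the passage through `ℝ≥0∞` lossless.
  obtain rfl : lamStar = lam₀ := by rw [hlamStar, hmax, ENNReal.toReal_ofReal h0]
  refine ⟨hmax ▸ ENNReal.ofReal_ne_top, fun b J lam hJ =>
    ⟨RISAccess.Network.integrable_probePayoff hJ b lam, fun n =>
      RISAccess.Network.condExp_probePayoff (hX n) (hlaw n) hJ b lam⟩,
    p.exists_followsRule lamStar, fun σ hσ => ?_, fun n lam => ?_⟩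
  · have hT := hσ.meanDuration_ne_top hX hlaw hind h0 hlam
    refine ⟨RISAccess.Network.ae_exists_stops hX σ hT, hT, ?_, ?_⟩
    · rw [hσ.meanVolume_eq hX hlaw hind h0 hlam]
      exact ENNReal.mul_ne_top ENNReal.ofReal_ne_top hT
    · rw [hσ.throughput_eq hX hlaw hind h0 hlam, hmax]
  · have hi := p.integrable_bestValue lam
    rw [← hlaw n] at hi
    have hmean : ∫ ω, p.bestValue lam (p.request (X n ω)) ∂P = p.meanBest lam := by
      rw [RISAccess.Network.meanBest, ← hlaw n, integral_map (hX n).aemeasurable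
        hi.aestronglyMeasurable]
    refine ⟨hi.comp_measurable (hX n), ?_⟩
    rw [hmean]
    exact ⟨fun h => p.meanBest_eq_unique h hlam, fun h => h ▸ hlam⟩
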